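/- Let $C>0$, $\alpha>2$, $P_{r,0}>0$, $\lambda_b>0$, $\lambda_u>0$ and $\sigma_n^2\ge 0$. Base stations (BSs) form a homogeneous Poisson point process $\Phi_b=\{X_j\}$ of density $\lambda_b$ in the plane. A user at the origin is served by its nearest BS, at distance $R=\min_j\|X_j\|$. Let $H$ and $H_j$ be i.i.d. exponential random variables with unit mean (Rayleigh fading), independent of $\Phi_b$. All transmitting BSs use the power $P_t=P_{r,0}/(C\lambda_b^{\alpha/2})$. Under the all-on scheme all BSs transmit, $\Phi_1=\Phi_b$. Under the on-off scheme only BSs with at least one user transmit, $\Phi_2=\{X_j: N_j\ge 1\}$, where the numbers $N_j$ of users in the cells are modelled as i.i.d., independent of $\Phi_b$, $H$ and $(H_j)$, with $$\mathbb P[N_j=n]=\frac{3.5^{3.5}\,\Gamma(n+3.5)\,\mu^n}{\Gamma(3.5)\,n!\,(\mu+3.5)^{n+3.5}},\qquad \mu=\lambda_u/\lambda_b,$$ so that $\mathbb P[N_j=0]=p_0(\mu)=(1+\mu/3.5)^{-3.5}$ and $\Phi_2$ is a thinned Poisson process of density $(1-p_0(\mu))\lambda_b$. For $k\in\{1,2\}$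 put $$\mathtt{SINR}_k=\frac{HCP_tR^{-\alpha}}{\sigma_n^2+\sum_{X_j\in\Phi_k,\ \|X_j\|>R}CP_tH_j\|X_j\|^{-\alpha}},\qquad \mathcal C_k=\mathbb E[\log_2(1+\mathtt{SINR}_k)],$$ and let $$\rho(T,\alpha)=\frac{2T}{\alpha-2}\;{}_2F_1\!\left(1,1-\tfrac2\alpha;2-\tfrac2\alpha;-T\right),\qquad T\ge 0,$$ where ${}_2F_1$ is the (analytically continued) Gaussian hypergeometric function. Then the interference sums converge almost surely, the expectations $\mathcal C_k$ and the double integrals below are finite, and $$\mathcal C_1=\pi\int_0^\infty\!\!\int_0^\infty \exp\!\Big(-\tfrac{\sigma_n^2(2^t-1)}{P_{r,0}}x^{\alpha/2}-\pi x\big(\rho(2^t-1,\alpha)+1\big)\Big)\,dx\,dt,$$ $$\mathcal C_2=\pi\int_0^\infty\!\!\int_0^\infty \exp\!\Big(-\tfrac{\sigma_n^2(2^t-1)}{P_{r,0}}x^{\alpha/2}-\pi x\big([1-p_0(\mu)]\,\rho(2^t-1,\alpha)+1\big)\Big)\,dx\,dt.$$ -/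

import Mathlib

open MeasureTheory ProbabilityTheory Set
open scoped ENNReal NNReal Nat

noncomputable section

/-! ### The Gaussian hypergeometric function on the half-line `z < 1` -/

/-- `F` is the continuation of the Gauss series `∑ (a)ₙ (b)ₙ / (c)ₙ * zⁿ / n!` from `(-1, 1)` to the
half-line `(-∞, 1)` as an analytic function. -/
structure IsGaussContinuation (a b c : ℝ) (F : ℝ → ℝ) : Prop where
  analytic : AnalyticOnNhd ℝ F (Iio 1)
  eq_series : ∀ z ∈ Ioo (-1 : ℝ) 1, F z = ordinaryHypergeometric a b c z

/-- The Gaussian hypergeometric function `₂F₁(a, b; c; z)` for real `z < 1`: the analytic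
continuation of the Gauss series.  (Mathlib's `ordinaryHypergeometric` is only the sum of the
series, which diverges for `z < -1`.) -/
def gaussHypergeometric (a b c : ℝ) : ℝ → ℝ :=
  Classical.epsilon (IsGaussContinuation a b c)

/-- The continuation is unique, so `gaussHypergeometric` is any function that continues the
series. -/
theorem IsGaussContinuation.gaussHypergeometric_eq {a b c : ℝ} {F : ℝ → ℝ}
    (hF : IsGaussContinuation a b c F) {z : ℝ} (hz : z < 1) :
    gaussHypergeometric a b c z = F z := by
  have hG : IsGaussContinuation a b c (gaussHypergeometric a b c) :=
    Classical.epsilon_spec (p := IsGaussContinuation a b c) ⟨F, hF⟩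
  refine hG.analytic.eqOn_of_preconnected_of_eventuallyEq hF.analytic isPreconnected_Iio
    (show (0 : ℝ) ∈ Iio 1 by simp) ?_ hz
  filter_upwards [Ioo_mem_nhds (show (-1 : ℝ) < 0 by norm_num) (show (0 : ℝ) < 1 by norm_num)]
    with w hw
  rw [hG.eq_series w hw, hF.eq_series w hw]

/-- `ρ(T, α) = (2 T / (α - 2)) ₂F₁(1, 1 - 2/α; 2 - 2/α; -T)`. -/
def rho (T α : ℝ) : ℝ :=
  2 * T / (α - 2) * gaussHypergeometric 1 (1 - 2 / α) (2 - 2 / α) (-T)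

/-! ### The network -/

/-- The Euclidean plane. -/
abbrev Plane : Type := EuclideanSpace ℝ (Fin 2)

/-- The number of points of the sequence `x` that lie in `A`. -/
def pointCount (x : ℕ → Plane) (A : Set Plane) : ℕ∞ := {j | x j ∈ A}.encard

/-- The random points `X 0, X 1, …` enumerate a homogeneous Poisson point process of density `lam`
in the plane: the number of points in a bounded-area set `A` is Poisson with mean `lam * area A`,
and the numbers of points in disjoint sets are independent.  (For `lam > 0` the process has
infinitely many points almost surely, so that an enumeration by `ℕ` loses nothing.) -/
structure IsPoissonProcess {Ω : Type*} [MeasurableSpace Ω] (P : Measure Ω)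
    (X : ℕ → Ω → Plane) (lam : ℝ) : Prop where
  measurable : ∀ j, Measurable (X j)
  count_law : ∀ A : Set Plane, MeasurableSet A → volume A ≠ ∞ → ∀ n : ℕ,
    P {ω | pointCount (fun j => X j ω) A = n} =
      poissonMeasure (Real.toNNReal (lam * volume.real A)) {n}
  indep : ∀ (m : ℕ) (A : Fin m → Set Plane), (∀ i, MeasurableSet (A i)) →
    (∀ i, volume (A i) ≠ ∞) → Pairwise (Function.onFun Disjoint A) →
    iIndepFun (fun i ω => pointCount (fun j => X j ω) (A i)) P

/-- Rayleigh fading: `H₀` (link from the serving base station) and `H j` (link from the base station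
`X j` when it interferes) are i.i.d. exponential with unit mean, independent of the locations. -/
structure IsRayleighFading {Ω : Type*} [MeasurableSpace Ω] (P : Measure Ω)
    (X : ℕ → Ω → Plane) (H₀ : Ω → ℝ) (H : ℕ → Ω → ℝ) : Prop where
  measurable_serving : Measurable H₀
  measurable_interf : ∀ j, Measurable (H j)
  law_serving : P.map H₀ = expMeasure 1
  law_interf : ∀ j, P.map (H j) = expMeasure 1
  iIndep : iIndepFun (fun o : Option ℕ => o.elim H₀ H) P
  indep_locations : IndepFun (fun ω j => X j ω) (fun ω => (H₀ ω, fun j => H j ω)) P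

/-- The probability that a cell has `n` users when the cell load is `μ`. -/
def cellCountProb (μ : ℝ) (n : ℕ) : ℝ :=
  (3.5 : ℝ) ^ (3.5 : ℝ) * Real.Gamma (n + 3.5) * μ ^ n /
    (Real.Gamma 3.5 * (n ! : ℝ) * (μ + 3.5) ^ ((n : ℝ) + 3.5))

/-- The numbers of users `N j` in the cells of the base stations `X j`, at cell load `μ`: they are
i.i.d. with law `cellCountProb μ`, and independent of the locations and of the fading. -/
structure IsCellCounts {Ω : Type*} [MeasurableSpace Ω] (P : Measure Ω)
    (X : ℕ → Ω → Plane) (H₀ : Ω → ℝ) (H : ℕ → Ω → ℝ) (N : ℕ → Ω → ℕ) (μ : ℝ) : Prop where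
  measurable : ∀ j, Measurable (N j)
  law : ∀ j n, P {ω | N j ω = n} = ENNReal.ofReal (cellCountProb μ n)
  iIndep : iIndepFun N P
  indep_rest : IndepFun (fun ω j => N j ω)
    (fun ω => ((fun j => X j ω : ℕ → Plane), H₀ ω, (fun j => H j ω : ℕ → ℝ))) P

/-- `p₀(μ) = (1 + μ / 3.5) ^ (-3.5)`. -/
def voidProb (μ : ℝ) : ℝ := (1 + μ / 3.5) ^ (-3.5 : ℝ)

/-- All-on power control: every base station transmits. -/
def allOn {Ω : Type*} : Ω → Set ℕ := fun _ => univ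

/-- On-off power control: the base stations with at least one user transmit. -/
def onOff {Ω : Type*} (N : ℕ → Ω → ℕ) : Ω → Set ℕ := fun ω => {j | N j ω ≠ 0}

/-- The transmit power `P_t = P_{r,0} / (C λ_b ^ (α / 2))`. -/
def transmitPower (C Pr0 lamb α : ℝ) : ℝ := Pr0 / (C * lamb ^ (α / 2))

/-- The distance from the user at the origin to the nearest base station, which serves it. -/
def servingDist {Ω : Type*} (X : ℕ → Ω → Plane) (ω : Ω) : ℝ := ⨅ j, ‖X j ω‖

/-- The power received from the base station `X j` as an interferer: `C P_t H_j ‖X_j‖ ^ (-α)` if it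
transmits and is farther away than the serving one, and `0` otherwise. -/
def interferenceTerm {Ω : Type*} (C Pt α : ℝ) (X : ℕ → Ω → Plane) (H : ℕ → Ω → ℝ)
    (active : Ω → Set ℕ) (ω : Ω) : ℕ → ℝ :=
  (active ω ∩ {j | servingDist X ω < ‖X j ω‖}).indicator
    (fun j => C * Pt * H j ω * ‖X j ω‖ ^ (-α))

/-- The signal-to-interference-plus-noise ratio of the user at the origin, with noise power `σ²`. -/
def sinr {Ω : Type*} (C Pt α σ : ℝ) (X : ℕ → Ω → Plane) (H₀ : Ω → ℝ) (H : ℕ → Ω → ℝ)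
    (active : Ω → Set ℕ) (ω : Ω) : ℝ :=
  H₀ ω * C * Pt * servingDist X ω ^ (-α) /
    (σ ^ 2 + ∑' j, interferenceTerm C Pt α X H active ω j)

/-- The maximum achievable rate `log₂ (1 + SINR)`. -/
def rate {Ω : Type*} (C Pt α σ : ℝ) (X : ℕ → Ω → Plane) (H₀ : Ω → ℝ) (H : ℕ → Ω → ℝ)
    (active : Ω → Set ℕ) (ω : Ω) : ℝ :=
  Real.logb 2 (1 + sinr C Pt α σ X H₀ H active ω)

end

/-! ### Point counts as sums over the points -/

open Filter Topology

/-! The mean rate is the integral over `t > 0` of the probability that the SINR exceeds `T = 2 ^ t -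
1`. Divide signal, noise and interference by the mean received signal. The power normalisation turns
the noise into `(σ² / Pr0) (λ R²) ^ (α / 2)`, and the interference becomes `∑ (R / ‖X_j‖) ^ α W_j`,
where the mark `W_j` is the fade of `X_j` if it transmits and zero otherwise. Let `Y` be the sum of
the two. The serving fade is exponential and independent of `Y`, so the probability sought is `E exp
(-T Y)`.

Both schemes are the same computation, with marks that are exponential with probability `q` and zero
otherwise: `q = 1` for all-on, `q = 1 - p₀` for on-off. No thinning theorem is needed, because a
silent station is a station with mark zero. Averaging over the marks gives each interferer the
factor `1 - q a / (1 + a)` with `a = T (R / ‖X_j‖) ^ α` (`IsFadingMarks.integral_exp_neg_tsum`).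
Given `R`, the remaining points are Poisson outside the ball of radius `R`
(`IsPoissonProcess.integral_servingDist_exp`), and the Laplace functional leaves `exp (-λ π R² q
ρ(T))`. Since `λ R²` is exponential with rate `π`, averaging over it produces the inner integral
(`IsFadingMarks.integral_exp_neg_relNoise`).

Conditioning on `R` uses no Palm theory: on `a ≤ R < m` a function that vanishes in the ball of
radius `m` is handled by subtracting two void events, and a grid of such intervals is refined.

The function `ρ` enters as `2 ∫ v T v^(-α) / (1 + T v^(-α)) dv` over `v > 1` (`rho_eq_integral`).
This is Euler's integral after a substitution; Euler's integral is analytic on `z < 1` and has the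
Gauss series near `0`, hence is the continuation. Finiteness of the rates and of the double
integrals comes from `ρ(T) ≥ (T ^ (2 / α) - 1) / 2` (`le_rho`), which makes the tail decay
exponentially in `t`. -/

theorem toENNReal_pointCount (x : ℕ → Plane) (A : Set Plane) :
    ((pointCount x A : ℕ∞) : ℝ≥0∞) = ∑' j, A.indicator (fun _ => (1 : ℝ≥0∞)) (x j) := by
  rw [pointCount, ← ENNReal.tsum_set_one, tsum_subtype {j | x j ∈ A} fun _ => (1 : ℝ≥0∞)]
  rfl

theorem summable_indicator_of_pointCount_ne_top {x : ℕ → Plane} {A : Set Plane}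
    (h : pointCount x A ≠ ⊤) (c : ℝ) : Summable fun j => A.indicator (fun _ => c) (x j) := by
  have hfin : {j | x j ∈ A}.Finite := Set.encard_ne_top_iff.1 h
  refine summable_of_hasFiniteSupport (hfin.subset fun j hj => ?_)
  by_contra hn
  exact hj (indicator_of_notMem (s := A) hn _)

theorem tsum_indicator_eq_toNat {x : ℕ → Plane} {A : Set Plane}
    (h : pointCount x A ≠ ⊤) (c : ℝ) :
    ∑' j, A.indicator (fun _ => c) (x j) = c * (pointCount x A).toNat := by
  have hfin : {j | x j ∈ A}.Finite := Set.encard_ne_top_iff.1 h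
  rw [tsum_eq_sum (s := hfin.toFinset)]
  · rw [Finset.sum_congr rfl (g := fun _ => c)]
    · rw [pointCount, hfin.encard_eq_coe_toFinset_card]
      simp [mul_comm]
    · intro j hj
      exact indicator_of_mem (by simpa using hj) _
  · intro j hj
    exact indicator_of_notMem (by simpa using hj) _

theorem measurable_real_tsum {β : Type*} [MeasurableSpace β] {f : ℕ → β → ℝ}
    (hf : ∀ j, Measurable (f j)) (hf0 : ∀ j x, 0 ≤ f j x) :
    Measurable fun x => ∑' j, f j x := by
  have h1 : ∀ x, ∑' j, f j x = (∑' j, ENNReal.ofReal (f j x)).toReal := by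
    intro x
    rw [ENNReal.tsum_toReal_eq fun _ => ENNReal.ofReal_ne_top]
    simp [ENNReal.toReal_ofReal (hf0 _ x)]
  simp_rw [h1]
  exact (Measurable.tsum fun j => (hf j).ennreal_ofReal).ennreal_toReal

/-! ### Poisson counts and Campbell's formula -/

section Poisson

variable {Ω : Type*} [MeasurableSpace Ω] {P : Measure Ω} {X : ℕ → Ω → Plane} {lam : ℝ}

theorem measurable_pointCount (hX : ∀ j, Measurable (X j)) {A : Set Plane}
    (hA : MeasurableSet A) : Measurable fun ω => pointCount (fun j => X j ω) A := by
  have h : Measurable fun ω => ((pointCount (fun j => X j ω) A : ℕ∞) : ℝ≥0∞) := by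
    simp_rw [toENNReal_pointCount]
    exact Measurable.tsum fun j => (measurable_const.indicator hA).comp (hX j)
  refine measurable_to_countable' fun n => ?_
  have : (fun ω => pointCount (fun j => X j ω) A) ⁻¹' {n} =
      (fun ω => ((pointCount (fun j => X j ω) A : ℕ∞) : ℝ≥0∞)) ⁻¹' {(n : ℝ≥0∞)} := by
    ext ω; simp
  rw [this]
  exact h (measurableSet_singleton _)

namespace IsPoissonProcess

variable [IsProbabilityMeasure P]

/-- The prescribed masses at finite counts already add up to one, so nothing is left for `⊤`.
Domination on atoms gives domination on all sets, and complements in two probability measures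
reverse it. -/
theorem map_pointCount (hX : IsPoissonProcess P X lam) {A : Set Plane} (hA : MeasurableSet A)
    (hA' : volume A ≠ ∞) :
    P.map (fun ω => pointCount (fun j => X j ω) A) =
      (poissonMeasure (lam * volume.real A).toNNReal).map (Nat.cast : ℕ → ℕ∞) := by
  set r := (lam * volume.real A).toNNReal
  have hm := measurable_pointCount hX.measurable hA
  have : IsProbabilityMeasure (P.map (fun ω => pointCount (fun j => X j ω) A)) :=
    Measure.isProbabilityMeasure_map hm.aemeasurable
  have key : ∀ n : ℕ, P.map (fun ω => pointCount (fun j => X j ω) A) {(n : ℕ∞)} =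
      (poissonMeasure r).map (Nat.cast : ℕ → ℕ∞) {(n : ℕ∞)} := by
    intro n
    rw [Measure.map_apply hm (measurableSet_singleton _),
      Measure.map_apply .of_discrete (measurableSet_singleton _)]
    have h1 : (Nat.cast : ℕ → ℕ∞) ⁻¹' {(n : ℕ∞)} = {n} := by ext; simp
    rw [h1, ← hX.count_law A hA hA' n]
    rfl
  have hle : (poissonMeasure r).map (Nat.cast : ℕ → ℕ∞) ≤
      P.map (fun ω => pointCount (fun j => X j ω) A) := by
    refine Measure.le_iff.2 fun s hs => ?_
    rw [← Measure.tsum_indicator_apply_singleton _ s hs, ← Measure.tsum_indicator_apply_singleton _ s hs]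
    refine ENNReal.tsum_le_tsum fun n => ?_
    refine indicator_le_indicator ?_
    induction n using ENat.recTopCoe with
    | top =>
      rw [Measure.map_apply .of_discrete (measurableSet_singleton _)]
      have h1 : (Nat.cast : ℕ → ℕ∞) ⁻¹' {(⊤ : ℕ∞)} = ∅ := by ext; simp
      simp [h1]
    | coe n => exact (key n).ge
  refine le_antisymm (Measure.le_iff.2 fun s hs => ?_) hle
  rw [← compl_compl s, prob_compl_eq_one_sub hs.compl, prob_compl_eq_one_sub hs.compl]
  exact tsub_le_tsub_left (hle _) _

theorem ae_pointCount_ne_top (hX : IsPoissonProcess P X lam) {A : Set Plane}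
    (hA : MeasurableSet A) (hA' : volume A ≠ ∞) :
    ∀ᵐ ω ∂P, pointCount (fun j => X j ω) A ≠ ⊤ := by
  have h : ∀ᵐ n ∂(P.map fun ω => pointCount (fun j => X j ω) A), n ≠ ⊤ := by
    rw [hX.map_pointCount hA hA']
    exact (ae_map_iff .of_discrete (measurableSet_singleton (⊤ : ℕ∞)).compl).2 (by simp)
  exact ae_of_ae_map (measurable_pointCount hX.measurable hA).aemeasurable h

theorem lintegral_pointCount (hX : IsPoissonProcess P X lam) {A : Set Plane}
    (hA : MeasurableSet A) (hA' : volume A ≠ ∞) :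
    ∫⁻ ω, ((pointCount (fun j => X j ω) A : ℕ∞) : ℝ≥0∞) ∂P =
      (lam * volume.real A).toNNReal := by
  set r := (lam * volume.real A).toNNReal with hr
  have h := lintegral_map (μ := P) (f := fun n : ℕ∞ => (n : ℝ≥0∞)) .of_discrete
    (measurable_pointCount hX.measurable hA)
  rw [← h, hX.map_pointCount hA hA', lintegral_map .of_discrete .of_discrete, ← hr,
    poissonMeasure, lintegral_sum_measure]
  simp only [lintegral_smul_measure, lintegral_dirac, smul_eq_mul, ENat.toENNReal_coe]
  rw [tsum_eq_zero_add' ENNReal.summable]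
  have h1 : ∀ n : ℕ, ENNReal.ofReal (Real.exp (-r) * r ^ (n + 1) / (n + 1)!) *
      ((n + 1 : ℕ) : ℝ≥0∞) = r * ENNReal.ofReal (Real.exp (-r) * r ^ n / n !) := by
    intro n
    rw [← ENNReal.ofReal_natCast, ← ENNReal.ofReal_coe_nnreal,
      ← ENNReal.ofReal_mul (by positivity), ← ENNReal.ofReal_mul (by positivity)]
    congr 1
    rw [Nat.factorial_succ]
    push_cast
    field_simp
    ring
  simp_rw [h1]
  rw [ENNReal.tsum_mul_left, ← ENNReal.ofReal_tsum_of_nonneg (fun n => by positivity)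
    (hasSum_one_poissonMeasure r).summable, (hasSum_one_poissonMeasure r).tsum_eq]
  simp

/-- Campbell's formula. -/
theorem lintegral_tsum (hX : IsPoissonProcess P X lam) (hlam : 0 ≤ lam) {F : Plane → ℝ≥0∞}
    (hF : Measurable F) :
    ∫⁻ ω, ∑' j, F (X j ω) ∂P = ENNReal.ofReal lam * ∫⁻ x, F x := by
  -- The intensity measure agrees with `lam` times area on sets of finite area, by the mean of the
  -- counts; exhausting the plane by balls gives the rest.
  have hν : Measure.sum (fun j => P.map (X j)) = ENNReal.ofReal lam • (volume : Measure Plane) := by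
    have key : ∀ A : Set Plane, MeasurableSet A → volume A ≠ ∞ →
        Measure.sum (fun j => P.map (X j)) A = (ENNReal.ofReal lam • (volume : Measure Plane)) A := by
      intro A hA hA'
      have h1 := hX.lintegral_pointCount hA hA'
      simp_rw [toENNReal_pointCount] at h1
      rw [MeasureTheory.lintegral_tsum (f := fun j ω => A.indicator (fun _ => (1 : ℝ≥0∞)) (X j ω)) fun j =>
        ((measurable_const.indicator hA).comp (hX.measurable j)).aemeasurable] at h1
      rw [Measure.sum_apply _ hA]
      calc ∑' j, (P.map (X j)) A
          = ∑' j, ∫⁻ ω, A.indicator (fun _ => (1 : ℝ≥0∞)) (X j ω) ∂P := by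
            refine tsum_congr fun j => ?_
            rw [← lintegral_map (f := A.indicator fun _ => (1 : ℝ≥0∞))
              (measurable_const.indicator hA) (hX.measurable j)]
            simp [lintegral_indicator hA]
        _ = _ := by
            rw [h1]
            simp only [Measure.smul_apply, smul_eq_mul]
            change ENNReal.ofReal (lam * volume.real A) = _
            rw [ENNReal.ofReal_mul hlam, measureReal_def, ENNReal.ofReal_toReal hA']
    ext A hA
    have hU : A = ⋃ n : ℕ, A ∩ Metric.ball 0 n := by
      rw [← inter_iUnion, Metric.iUnion_ball_nat, inter_univ]
    have hmono : Monotone fun n : ℕ => A ∩ Metric.ball (0 : Plane) n := fun m n h =>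
      inter_subset_inter_right _ (Metric.ball_subset_ball (by exact_mod_cast h))
    rw [hU, hmono.measure_iUnion, hmono.measure_iUnion]
    refine iSup_congr fun n => key _ (hA.inter Metric.isOpen_ball.measurableSet) ?_
    exact ((measure_mono inter_subset_right).trans_lt measure_ball_lt_top).ne
  rw [MeasureTheory.lintegral_tsum (f := fun j ω => F (X j ω))
    fun j => (hF.comp (hX.measurable j)).aemeasurable]
  calc ∑' j, ∫⁻ ω, F (X j ω) ∂P = ∑' j, ∫⁻ x, F x ∂(P.map (X j)) :=
        tsum_congr fun j => (lintegral_map hF (hX.measurable j)).symm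
    _ = _ := by
        rw [← lintegral_sum_measure, hν, lintegral_smul_measure, smul_eq_mul]

/-- By Campbell's formula the sum has finite expectation. -/
theorem ae_summable (hX : IsPoissonProcess P X lam) (hlam : 0 ≤ lam) {F : Plane → ℝ}
    (hF : Integrable F) (hFm : Measurable F) (hF0 : ∀ x, 0 ≤ F x) :
    ∀ᵐ ω ∂P, Summable fun j => F (X j ω) := by
  have h := hX.lintegral_tsum hlam (F := fun x => ENNReal.ofReal (F x)) hFm.ennreal_ofReal
  have hfin : ∫⁻ ω, ∑' j, ENNReal.ofReal (F (X j ω)) ∂P ≠ ∞ := by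
    rw [h]
    exact ENNReal.mul_ne_top ENNReal.ofReal_ne_top
      (hF.lintegral_lt_top).ne
  have hm : Measurable fun ω => ∑' j, ENNReal.ofReal (F (X j ω)) :=
    Measurable.tsum fun j => (hFm.comp (hX.measurable j)).ennreal_ofReal
  filter_upwards [ae_lt_top hm hfin] with ω hω
  have := ENNReal.summable_toReal hω.ne
  simpa [ENNReal.toReal_ofReal (hF0 _)] using this

/-- The generating function of the Poisson law at `exp (-c)`. -/
theorem integral_exp_neg_pointCount (hX : IsPoissonProcess P X lam) (hlam : 0 ≤ lam)
    {A : Set Plane} (hA : MeasurableSet A) (hA' : volume A ≠ ∞) (c : ℝ) :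
    ∫ ω, Real.exp (-(c * (pointCount (fun j => X j ω) A).toNat)) ∂P =
      Real.exp (-(lam * ((1 - Real.exp (-c)) * volume.real A))) := by
  have h := integral_map (μ := P) (measurable_pointCount hX.measurable hA).aemeasurable
    (f := fun n : ℕ∞ => Real.exp (-(c * n.toNat))) Measurable.of_discrete.aestronglyMeasurable
  rw [← h, hX.map_pointCount hA hA',
    integral_map .of_discrete Measurable.of_discrete.aestronglyMeasurable,
    integral_poissonMeasure]
  rw [Real.coe_toNNReal _ (by positivity)]
  set r := lam * volume.real A
  have h1 : ∀ n : ℕ, (Real.exp (-r) * r ^ n / n !) • Real.exp (-(c * ((n : ℕ∞).toNat : ℝ))) =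
      Real.exp (-r) * ((r * Real.exp (-c)) ^ n / n !) := by
    intro n
    rw [mul_pow r, ← Real.exp_nat_mul, smul_eq_mul, ENat.toNat_natCast,
      show (n : ℝ) * -c = -(c * n) by ring]
    ring
  simp_rw [h1]
  rw [tsum_mul_left, (NormedSpace.expSeries_div_hasSum_exp (r * Real.exp (-c))).tsum_eq,
    ← Real.exp_eq_exp_ℝ, ← Real.exp_add]
  congr 1
  ring

end IsPoissonProcess

end Poisson

/-! ### The Laplace functional -/

section Laplace

variable {Ω : Type*} [MeasurableSpace Ω] {P : Measure Ω} {X : ℕ → Ω → Plane} {lam : ℝ}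

namespace IsPoissonProcess

variable [IsProbabilityMeasure P]

/-- Counts in disjoint sets are independent, so the expectation is a product of Poisson transforms.
The exponents recombine into one integral because at most one indicator is non-zero at each point.
-/
theorem integral_exp_neg_sum (hX : IsPoissonProcess P X lam) (hlam : 0 ≤ lam)
    {m : ℕ} (A : Fin m → Set Plane) (hA : ∀ i, MeasurableSet (A i)) (hA' : ∀ i, volume (A i) ≠ ∞)
    (hd : Pairwise (Function.onFun Disjoint A)) (c : Fin m → ℝ) :
    ∫ ω, Real.exp (-∑' j, ∑ i, (A i).indicator (fun _ => c i) (X j ω)) ∂P =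
      Real.exp (-(lam * ∫ x, (1 - Real.exp (-∑ i, (A i).indicator (fun _ => c i) x)))) := by
  have h1 : ∀ᵐ ω ∂P, Real.exp (-∑' j, ∑ i, (A i).indicator (fun _ => c i) (X j ω)) =
      ∏ i, Real.exp (-(c i * (pointCount (fun j => X j ω) (A i)).toNat)) := by
    filter_upwards [ae_all_iff.2 fun i => hX.ae_pointCount_ne_top (hA i) (hA' i)] with ω hω
    rw [← Real.exp_sum, Finset.sum_neg_distrib,
      Summable.tsum_finsetSum fun i _ => summable_indicator_of_pointCount_ne_top (hω i) (c i)]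
    simp_rw [tsum_indicator_eq_toNat (hω _)]
  have hmeas : ∀ i, Measurable fun n : ℕ∞ => Real.exp (-(c i * (n.toNat : ℝ))) :=
    fun i => .of_discrete
  have hcomp := (hX.indep m A hA hA' hd).comp (fun i n => Real.exp (-(c i * (n.toNat : ℝ)))) hmeas
  rw [integral_congr_ae h1]
  have h2 := hcomp.integral_fun_prod_eq_prod_integral fun i =>
    ((hmeas i).comp (measurable_pointCount hX.measurable (hA i))).aestronglyMeasurable
  simp only [Function.comp_def] at h2
  rw [h2]
  simp_rw [hX.integral_exp_neg_pointCount hlam (hA _) (hA' _)]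
  rw [← Real.exp_sum, Finset.sum_neg_distrib, ← Finset.mul_sum]
  congr 3
  have h3 : ∀ x, 1 - Real.exp (-∑ i, (A i).indicator (fun _ => c i) x) =
      ∑ i, (A i).indicator (fun _ => 1 - Real.exp (-c i)) x := by
    intro x
    by_cases hx : ∃ i, x ∈ A i
    · obtain ⟨i, hi⟩ := hx
      have hne : ∀ k, k ≠ i → x ∉ A k := fun k hk hxk =>
        Set.disjoint_left.1 (hd hk) hxk hi
      rw [Finset.sum_eq_single i (fun k _ hk => indicator_of_notMem (hne k hk) _) (by simp),
        Finset.sum_eq_single i (fun k _ hk => indicator_of_notMem (hne k hk) _) (by simp),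
        indicator_of_mem hi, indicator_of_mem hi]
    · push Not at hx
      simp [indicator_of_notMem (hx _)]
  simp_rw [h3]
  rw [integral_finsetSum _ fun i _ => (integrableOn_const (hA' i)).integrable_indicator (hA i)]
  · refine Finset.sum_congr rfl fun i _ => ?_
    rw [integral_indicator_const _ (hA i), smul_eq_mul, mul_comm]

/-- The level sets of the non-zero values are disjoint and, by integrability, of finite area. The
value `0` is left out since its level set has infinite area. -/
theorem integral_exp_neg_simpleFunc (hX : IsPoissonProcess P X lam) (hlam : 0 ≤ lam)
    (s : SimpleFunc Plane ℝ) (hs : Integrable s) :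
    ∫ ω, Real.exp (-∑' j, s (X j ω)) ∂P =
      Real.exp (-(lam * ∫ x, (1 - Real.exp (-s x)))) := by
  set K := s.range.filter (· ≠ 0)
  let e := K.equivFin.symm
  have hval : ∀ x, s x = ∑ i, (s ⁻¹' {(e i : ℝ)}).indicator (fun _ => (e i : ℝ)) x := by
    intro x
    by_cases hx : s x = 0
    · rw [Finset.sum_eq_zero, hx]
      intro i _
      refine indicator_of_notMem (fun h => ?_) _
      have h0 := (Finset.mem_filter.1 (e i).2).2
      exact h0 ((show s x = e i from h).symm.trans hx)
    · have hm : s x ∈ K := Finset.mem_filter.2 ⟨s.mem_range_self x, hx⟩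
      rw [Finset.sum_eq_single (e.symm ⟨s x, hm⟩)]
      · simp
      · intro i _ hi
        refine indicator_of_notMem (fun h => hi ?_) _
        rw [Equiv.eq_symm_apply]
        exact Subtype.ext (show s x = e i from h).symm
      · simp
  simp_rw [hval]
  refine hX.integral_exp_neg_sum hlam _ (fun i => s.measurableSet_preimage _) (fun i => ?_) ?_ _
  · exact (SimpleFunc.measure_preimage_lt_top_of_integrable s hs
      (Finset.mem_filter.1 (e i).2).2).ne
  · intro i j hij
    refine Set.disjoint_left.2 fun x hi hj => hij (e.injective (Subtype.ext ?_))
    exact (show s x = e i from hi).symm.trans hj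

/-- The Laplace functional of a Poisson process. -/
theorem integral_exp_neg_tsum (hX : IsPoissonProcess P X lam) (hlam : 0 ≤ lam) {F : Plane → ℝ}
    (hF : Integrable F) (hFm : Measurable F) (hF0 : ∀ x, 0 ≤ F x) :
    ∫ ω, Real.exp (-∑' j, F (X j ω)) ∂P =
      Real.exp (-(lam * ∫ x, (1 - Real.exp (-F x)))) := by
  let G : Plane → ℝ≥0∞ := fun x => ENNReal.ofReal (F x)
  have hG : Measurable G := hFm.ennreal_ofReal
  -- Approximation from below by simple functions. The same bound `F` dominates the series over the
  -- points and, through `1 - exp (-u) ≤ u`, the integral over the plane.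
  let s : ℕ → SimpleFunc Plane ℝ := fun n => (SimpleFunc.eapprox G n).map ENNReal.toReal
  have hs0 : ∀ n x, 0 ≤ s n x := fun n x => ENNReal.toReal_nonneg
  have hsle : ∀ n x, s n x ≤ F x := by
    intro n x
    have h := (SimpleFunc.iSup_eapprox_apply hG x).symm ▸
      le_iSup (fun n => (SimpleFunc.eapprox G n : Plane → ℝ≥0∞) x) n
    exact ENNReal.toReal_le_of_le_ofReal (hF0 x) h
  have hstend : ∀ x, Tendsto (fun n => s n x) atTop (𝓝 (F x)) := by
    intro x
    have h := (ENNReal.tendsto_toReal (a := G x) ENNReal.ofReal_ne_top).comp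
      (SimpleFunc.tendsto_eapprox hG x)
    rwa [show (G x).toReal = F x from ENNReal.toReal_ofReal (hF0 x)] at h
  have hsint : ∀ n, Integrable (s n) := fun n =>
    hF.mono (s n).measurable.aestronglyMeasurable (.of_forall fun x => by
      rw [Real.norm_of_nonneg (hs0 n x), Real.norm_of_nonneg (hF0 x)]; exact hsle n x)
  have hL : Tendsto (fun n => ∫ ω, Real.exp (-∑' j, s n (X j ω)) ∂P) atTop
      (𝓝 (∫ ω, Real.exp (-∑' j, F (X j ω)) ∂P)) := by
    refine tendsto_integral_of_dominated_convergence (fun _ => (1 : ℝ)) (fun n => ?_)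
      (integrable_const _) (fun n => .of_forall fun ω => ?_) ?_
    · have hm := measurable_real_tsum (f := fun j ω => s n (X j ω))
        (fun j => (s n).measurable.comp (hX.measurable j)) fun j ω => hs0 n _
      exact hm.neg.exp.aestronglyMeasurable
    · rw [Real.norm_of_nonneg (Real.exp_nonneg _), Real.exp_le_one_iff, neg_nonpos]
      exact tsum_nonneg fun j => hs0 n _
    · filter_upwards [hX.ae_summable hlam hF hFm hF0] with ω hω
      refine (Real.continuous_exp.tendsto _).comp (Tendsto.neg ?_)
      exact tendsto_tsum_of_dominated_convergence hω (fun j => hstend _)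
        (.of_forall fun n j => by rw [Real.norm_of_nonneg (hs0 n _)]; exact hsle n _)
  have hR : Tendsto (fun n => Real.exp (-(lam * ∫ x, (1 - Real.exp (-s n x))))) atTop
      (𝓝 (Real.exp (-(lam * ∫ x, (1 - Real.exp (-F x)))))) := by
    refine (Real.continuous_exp.tendsto _).comp (Tendsto.neg (Tendsto.const_mul _ ?_))
    refine tendsto_integral_of_dominated_convergence F (fun n => ?_) hF
      (fun n => .of_forall fun x => ?_) (.of_forall fun x => ?_)
    · exact (measurable_const.sub (s n).measurable.neg.exp).aestronglyMeasurable
    · have h1 := Real.exp_le_one_iff.2 (neg_nonpos.2 (hs0 n x))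
      have h2 := Real.add_one_le_exp (-s n x)
      rw [Real.norm_of_nonneg (by linarith)]
      linarith [hsle n x]
    · exact tendsto_const_nhds.sub ((Real.continuous_exp.tendsto _).comp (hstend x).neg)
  refine tendsto_nhds_unique hL ?_
  simp_rw [hX.integral_exp_neg_simpleFunc hlam (s _) (hsint _)]
  exact hR

/-- The Laplace functional of a Poisson process outside `A`, on the event that `A` is empty. -/
theorem setIntegral_exp_neg_tsum (hX : IsPoissonProcess P X lam) (hlam : 0 ≤ lam)
    {A : Set Plane} (hA : MeasurableSet A) (hA' : volume A ≠ ∞) {F : Plane → ℝ}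
    (hF : Integrable F) (hFm : Measurable F) (hF0 : ∀ x, 0 ≤ F x) (hFA : ∀ x ∈ A, F x = 0) :
    ∫ ω in {ω | ∀ j, X j ω ∉ A}, Real.exp (-∑' j, F (X j ω)) ∂P =
      Real.exp (-(lam * volume.real A)) *
        Real.exp (-(lam * ∫ x, (1 - Real.exp (-F x)))) := by
  have hS : MeasurableSet {ω | ∀ j, X j ω ∉ A} := by
    rw [ofPred_forall]
    exact MeasurableSet.iInter fun j => (hX.measurable j hA).compl
  have hint1 : ∀ c : ℝ, Integrable (A.indicator fun _ => c) := fun c =>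
    (integrableOn_const hA').integrable_indicator hA
  have hint2 : Integrable fun x => 1 - Real.exp (-F x) := by
    refine hF.mono (measurable_const.sub hFm.neg.exp).aestronglyMeasurable (.of_forall fun x => ?_)
    have h1 := Real.exp_le_one_iff.2 (neg_nonpos.2 (hF0 x))
    have h2 := Real.add_one_le_exp (-F x)
    rw [Real.norm_of_nonneg (by linarith), Real.norm_of_nonneg (hF0 x)]
    linarith
  -- A penalty `n` on each point in `A`: as `n` grows, the penalty factor tends to the indicator of
  -- the event that `A` is empty.
  have key : ∀ n : ℕ, ∫ ω, Real.exp (-∑' j, (F (X j ω) + A.indicator (fun _ => (n : ℝ)) (X j ω))) ∂P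
      = Real.exp (-(lam * ((1 - Real.exp (-n)) * volume.real A +
        ∫ x, (1 - Real.exp (-F x))))) := by
    intro n
    rw [hX.integral_exp_neg_tsum hlam (F := fun x => F x + A.indicator (fun _ => (n : ℝ)) x)
      (hF.add (hint1 n)) (hFm.add (measurable_const.indicator hA))
      fun x => add_nonneg (hF0 x) (indicator_nonneg (fun _ _ => n.cast_nonneg) x)]
    have h1 : ∀ x, 1 - Real.exp (-(F x + A.indicator (fun _ => (n : ℝ)) x)) =
        A.indicator (fun _ => 1 - Real.exp (-n)) x + (1 - Real.exp (-F x)) := by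
      intro x
      by_cases hx : x ∈ A
      · simp [hx, hFA x hx]
      · simp [hx]
    simp_rw [h1]
    rw [integral_add (hint1 _) hint2, integral_indicator_const _ hA, smul_eq_mul,
      mul_comm (volume.real A)]
  have hR : Tendsto (fun n : ℕ => Real.exp (-(lam * ((1 - Real.exp (-n)) * volume.real A +
      ∫ x, (1 - Real.exp (-F x)))))) atTop (𝓝 (Real.exp (-(lam * ((1 - 0) * volume.real A +
      ∫ x, (1 - Real.exp (-F x))))))) := by
    refine (Real.continuous_exp.tendsto _).comp (Tendsto.neg (Tendsto.const_mul _ ?_))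
    refine Tendsto.add_const _ (Tendsto.mul_const _ (tendsto_const_nhds.sub ?_))
    exact Real.tendsto_exp_neg_atTop_nhds_zero.comp tendsto_natCast_atTop_atTop
  have hL : Tendsto (fun n : ℕ => ∫ ω, Real.exp (-∑' j, (F (X j ω) +
      A.indicator (fun _ => (n : ℝ)) (X j ω))) ∂P) atTop
      (𝓝 (∫ ω, {ω | ∀ j, X j ω ∉ A}.indicator (fun ω => Real.exp (-∑' j, F (X j ω))) ω ∂P)) := by
    have hFt := measurable_real_tsum (f := fun j ω => F (X j ω))
      (fun j => hFm.comp (hX.measurable j)) fun j ω => hF0 _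
    have hae : ∀ n : ℕ, ∀ᵐ ω ∂P, Real.exp (-∑' j, (F (X j ω) +
        A.indicator (fun _ => (n : ℝ)) (X j ω))) =
        Real.exp (-(∑' j, F (X j ω) + n * (pointCount (fun j => X j ω) A).toNat)) := by
      intro n
      filter_upwards [hX.ae_summable hlam hF hFm hF0, hX.ae_pointCount_ne_top hA hA'] with ω h1 h2
      rw [h1.tsum_add (summable_indicator_of_pointCount_ne_top h2 _), tsum_indicator_eq_toNat h2]
    refine Tendsto.congr (fun n => (integral_congr_ae (hae n)).symm) ?_
    refine tendsto_integral_of_dominated_convergence (fun _ => (1 : ℝ)) (fun n => ?_)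
      (integrable_const _) (fun n => .of_forall fun ω => ?_) ?_
    · have h3 : Measurable fun n : ℕ∞ => (n.toNat : ℝ) := .of_discrete
      exact (hFt.add ((h3.comp
        (measurable_pointCount hX.measurable hA)).const_mul _)).neg.exp.aestronglyMeasurable
    · rw [Real.norm_of_nonneg (Real.exp_nonneg _), Real.exp_le_one_iff, neg_nonpos]
      exact add_nonneg (tsum_nonneg fun j => hF0 _) (by positivity)
    · filter_upwards [hX.ae_pointCount_ne_top hA hA'] with ω h2
      have h4 : (pointCount (fun j => X j ω) A).toNat = 0 ↔ ∀ j, X j ω ∉ A := by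
        rw [ENat.toNat_eq_zero, or_iff_left h2, pointCount, Set.encard_eq_zero,
          Set.eq_empty_iff_forall_notMem]
        rfl
      by_cases hω : ∀ j, X j ω ∉ A
      · rw [indicator_of_mem (by exact hω), h4.2 hω]
        simp
      · rw [indicator_of_notMem (by exact hω)]
        have hpos : 0 < (pointCount (fun j => X j ω) A).toNat :=
          Nat.pos_of_ne_zero fun h => hω (h4.1 h)
        refine Real.tendsto_exp_neg_atTop_nhds_zero.comp (tendsto_atTop_add_const_left _ _ ?_)
        exact tendsto_natCast_atTop_atTop.atTop_mul_const (by exact_mod_cast hpos)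
  rw [integral_indicator hS] at hL
  simp_rw [key] at hL
  rw [tendsto_nhds_unique hL hR, ← Real.exp_add]
  congr 1
  ring

end IsPoissonProcess

end Laplace

/-! ### Radial integrals in the plane -/

theorem volume_real_ball_plane {r : ℝ} (hr : 0 ≤ r) :
    volume.real (Metric.ball (0 : Plane) r) = Real.pi * r ^ 2 := by
  rw [measureReal_def, EuclideanSpace.volume_ball_fin_two, ENNReal.toReal_mul, ENNReal.toReal_pow,
    ENNReal.toReal_ofReal hr, mul_comm, ENNReal.toReal_ofReal Real.pi_pos.le]

theorem integral_norm_plane (f : ℝ → ℝ) :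
    ∫ x : Plane, f ‖x‖ = 2 * Real.pi * ∫ y in Ioi (0 : ℝ), y * f y := by
  rw [integral_fun_norm_addHaar volume f, volume_real_ball_plane zero_le_one]
  simp [finrank_euclideanSpace]
  ring

theorem integrable_norm_plane_iff {f : ℝ → ℝ} :
    Integrable (fun x : Plane => f ‖x‖) ↔ IntegrableOn (fun y : ℝ => y * f y) (Ioi 0) := by
  rw [integrable_fun_norm_addHaar volume (f := f)]
  simp [finrank_euclideanSpace]

/-- The function `x ↦ h (‖x‖ / m)` outside the ball of radius `m`, and `0` inside. -/
noncomputable def outerProfile (h : ℝ → ℝ) (m : ℝ) (x : Plane) : ℝ :=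
  if m ≤ ‖x‖ then h (‖x‖ / m) else 0

section OuterProfile

variable {h : ℝ → ℝ} {m : ℝ}

theorem outerProfile_nonneg (h0 : ∀ v, 1 ≤ v → 0 ≤ h v) (hm : 0 < m) (x : Plane) :
    0 ≤ outerProfile h m x := by
  unfold outerProfile
  split_ifs with hx
  · exact h0 _ ((one_le_div hm).2 hx)
  · exact le_rfl

theorem measurable_outerProfile (hh : Measurable h) :
    Measurable fun p : ℝ × Plane => outerProfile h p.1 p.2 :=
  Measurable.ite (measurableSet_le measurable_fst measurable_snd.norm)
    (hh.comp (measurable_snd.norm.div measurable_fst)) measurable_const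

theorem integrable_rpow_outside {α : ℝ} (hα : 2 < α) (hm : 0 < m) :
    Integrable fun x : Plane => if m ≤ ‖x‖ then ‖x‖ ^ (-α) else 0 := by
  rw [integrable_norm_plane_iff (f := fun r => if m ≤ r then r ^ (-α) else 0)]
  have h1 : IntegrableOn (fun y : ℝ => y ^ (1 - α)) (Ici m) := by
    rw [integrableOn_Ici_iff_integrableOn_Ioi]
    exact integrableOn_Ioi_rpow_of_lt (by linarith) hm
  have h2 := (integrable_indicator_iff measurableSet_Ici).2 h1
  refine h2.integrableOn.congr_fun (fun y hy => ?_) measurableSet_Ioi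
  have hy' : (0 : ℝ) < y := hy
  by_cases hmy : m ≤ y
  · rw [indicator_of_mem (by exact hmy)]
    simp only [hmy, if_true]
    rw [sub_eq_add_neg, Real.rpow_add hy', Real.rpow_one]
  · rw [indicator_of_notMem (by exact hmy)]
    simp [hmy]

theorem outerProfile_le {α C : ℝ} (hle : ∀ v, 1 ≤ v → h v ≤ C * v ^ (-α)) (hm : 0 < m)
    (x : Plane) :
    outerProfile h m x ≤ C * m ^ α * if m ≤ ‖x‖ then ‖x‖ ^ (-α) else 0 := by
  unfold outerProfile
  split_ifs with hx
  · refine (hle _ ((one_le_div hm).2 hx)).trans_eq ?_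
    rw [Real.div_rpow (norm_nonneg _) hm.le, Real.rpow_neg hm.le, div_inv_eq_mul]
    ring
  · simp

theorem integrable_outerProfile {α C : ℝ} (hα : 2 < α) (hh : Measurable h)
    (h0 : ∀ v, 1 ≤ v → 0 ≤ h v) (hle : ∀ v, 1 ≤ v → h v ≤ C * v ^ (-α)) (hm : 0 < m) :
    Integrable (outerProfile h m) := by
  refine ((integrable_rpow_outside hα hm).const_mul (C * m ^ α)).mono'
    ((measurable_outerProfile hh).comp measurable_prodMk_left).aestronglyMeasurable
    (.of_forall fun x => ?_)
  rw [Real.norm_of_nonneg (outerProfile_nonneg h0 hm x)]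
  exact outerProfile_le hle hm x

/-- Polar coordinates and the substitution `‖x‖ = m * v`. The profile depends on `‖x‖ / m` only, so
the radius comes out as the factor `m ^ 2`. -/
theorem integral_one_sub_exp_outerProfile (hm : 0 < m) :
    ∫ x, (1 - Real.exp (-outerProfile h m x)) =
      Real.pi * m ^ 2 * (2 * ∫ v in Ioi (1 : ℝ), v * (1 - Real.exp (-h v))) := by
  have h1 := integral_norm_plane (fun r => 1 - Real.exp (-if m ≤ r then h (r / m) else 0))
  unfold outerProfile
  rw [h1]
  have h2 : ∫ y in Ioi (0 : ℝ), y * (1 - Real.exp (-if m ≤ y then h (y / m) else 0)) =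
      ∫ y in Ioi (0 : ℝ), m * ((Ici (1 : ℝ)).indicator
        (fun v => v * (1 - Real.exp (-h v))) (m⁻¹ * y)) := by
    refine setIntegral_congr_fun measurableSet_Ioi fun y hy => ?_
    by_cases hmy : m ≤ y
    · have : m⁻¹ * y ∈ Ici (1 : ℝ) := by
        rw [mem_Ici, inv_mul_eq_div]; exact (one_le_div hm).2 hmy
      simp only [hmy, if_true, indicator_of_mem this]
      rw [inv_mul_eq_div]
      field_simp
    · have : m⁻¹ * y ∉ Ici (1 : ℝ) := by
        rw [mem_Ici, inv_mul_eq_div, one_le_div hm]; exact hmy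
      simp [hmy, indicator_of_notMem this]
  rw [h2, integral_const_mul, integral_comp_mul_left_Ioi _ _ (inv_pos.2 hm), mul_zero,
    setIntegral_indicator measurableSet_Ici]
  have h3 : Ioi (0 : ℝ) ∩ Ici 1 = Ici 1 := inter_eq_right.2 fun x hx => by
    exact zero_lt_one.trans_le (mem_Ici.1 hx)
  rw [h3, integral_Ici_eq_integral_Ioi, inv_inv, smul_eq_mul]
  ring

end OuterProfile

/-! ### The distance to the nearest point -/

section ServingDist

variable {Ω : Type*} {X : ℕ → Ω → Plane}

theorem le_servingDist_iff {ω : Ω} {r : ℝ} : r ≤ servingDist X ω ↔ ∀ j, r ≤ ‖X j ω‖ :=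
  le_ciInf_iff ⟨0, by rintro _ ⟨j, rfl⟩; exact norm_nonneg _⟩

theorem servingDist_nonneg (ω : Ω) : 0 ≤ servingDist X ω :=
  le_servingDist_iff.2 fun _ => norm_nonneg _

theorem setOf_le_servingDist (r : ℝ) :
    {ω | r ≤ servingDist X ω} = {ω | ∀ j, X j ω ∉ Metric.ball (0 : Plane) r} := by
  ext ω
  simp [le_servingDist_iff]

variable [MeasurableSpace Ω] {P : Measure Ω} {lam : ℝ}

theorem measurable_servingDist (hX : ∀ j, Measurable (X j)) : Measurable (servingDist X) :=
  Measurable.iInf fun j => (hX j).norm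

namespace IsPoissonProcess

variable [IsProbabilityMeasure P]

/-- This is the void probability of a ball, the Laplace functional with `F = 0`. -/
theorem measureReal_le_servingDist (hX : IsPoissonProcess P X lam) (hlam : 0 ≤ lam) {r : ℝ}
    (hr : 0 ≤ r) : P.real {ω | r ≤ servingDist X ω} = Real.exp (-(lam * (Real.pi * r ^ 2))) := by
  have h := hX.setIntegral_exp_neg_tsum hlam (A := Metric.ball 0 r) Metric.isOpen_ball.measurableSet
    measure_ball_lt_top.ne (F := fun _ => 0) (integrable_zero _ _ _) measurable_const
    (fun _ => le_rfl) (fun _ _ => rfl)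
  rw [← setOf_le_servingDist, volume_real_ball_plane hr] at h
  simpa using h

/-- Void probabilities determine the law on the half-lines `Ici a`. The scaling by `lam` removes the
density from the answer. -/
theorem map_servingDist_sq (hX : IsPoissonProcess P X lam) (hlam : 0 < lam) :
    P.map (fun ω => lam * servingDist X ω ^ 2) = expMeasure Real.pi := by
  have hm : Measurable fun ω => lam * servingDist X ω ^ 2 :=
    ((measurable_servingDist hX.measurable).pow_const 2).const_mul lam
  have : IsProbabilityMeasure (expMeasure Real.pi) := isProbabilityMeasure_expMeasure Real.pi_pos
  have : IsProbabilityMeasure (P.map fun ω => lam * servingDist X ω ^ 2) :=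
    Measure.isProbabilityMeasure_map hm.aemeasurable
  have hac : expMeasure Real.pi ≪ volume := withDensity_absolutelyContinuous _ _
  refine Measure.ext_of_Ici _ _ fun a => ?_
  rw [← ENNReal.toReal_eq_toReal_iff' (measure_ne_top _ _) (measure_ne_top _ _)]
  change (P.map _).real _ = (expMeasure Real.pi).real _
  rw [map_measureReal_apply hm measurableSet_Ici]
  have hexp : (expMeasure Real.pi).real (Ici a) = 1 - cdf (expMeasure Real.pi) a := by
    have h0 : expMeasure Real.pi {a} = 0 := hac (by simp)
    rw [cdf_eq_real, ← probReal_compl_eq_one_sub measurableSet_Iic, compl_Iic,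
      measureReal_def, measureReal_def, ← Ioi_union_left, measure_union (by simp) (by simp), h0,
      add_zero]
  rw [hexp, cdf_expMeasure_eq Real.pi_pos]
  split_ifs with ha
  · have h1 : (fun ω => lam * servingDist X ω ^ 2) ⁻¹' Ici a =
        {ω | Real.sqrt (a / lam) ≤ servingDist X ω} := by
      ext ω
      simp only [mem_preimage, mem_Ici, mem_ofPred_eq]
      rw [Real.sqrt_le_left (servingDist_nonneg ω), div_le_iff₀' hlam]
    rw [h1, hX.measureReal_le_servingDist hlam.le (Real.sqrt_nonneg _),
      Real.sq_sqrt (by positivity), sub_sub_cancel]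
    congr 2
    field_simp
  · have h1 : (fun ω => lam * servingDist X ω ^ 2) ⁻¹' Ici a = univ :=
      eq_univ_of_forall fun ω => by
        have : 0 ≤ lam * servingDist X ω ^ 2 := by positivity
        simp only [mem_preimage, mem_Ici]
        linarith
    simp [h1]

theorem ae_servingDist_pos (hX : IsPoissonProcess P X lam) (hlam : 0 < lam) :
    ∀ᵐ ω ∂P, 0 < servingDist X ω := by
  have hm : Measurable fun ω => lam * servingDist X ω ^ 2 :=
    ((measurable_servingDist hX.measurable).pow_const 2).const_mul lam
  have h : ∀ᵐ z ∂(P.map fun ω => lam * servingDist X ω ^ 2), z ≠ 0 := by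
    rw [hX.map_servingDist_sq hlam]
    exact (withDensity_absolutelyContinuous _ _).ae_le (Measure.ae_ne volume 0)
  filter_upwards [ae_of_ae_map hm.aemeasurable h] with ω hω
  refine (servingDist_nonneg ω).lt_of_ne fun h0 => hω ?_
  rw [← h0]; simp

end IsPoissonProcess

end ServingDist

/-! ### Conditioning on the nearest distance, by discretisation -/

/-- The least multiple of `1 / (n + 1)` that exceeds `r ≥ 0`. -/
noncomputable def gridCeil (n : ℕ) (r : ℝ) : ℝ := (⌊r * (n + 1)⌋₊ + 1) / (n + 1)

theorem lt_gridCeil (n : ℕ) (r : ℝ) : r < gridCeil n r := by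
  rw [gridCeil, lt_div_iff₀ (by positivity)]
  exact Nat.lt_floor_add_one _

theorem gridCeil_le (n : ℕ) {r : ℝ} (hr : 0 ≤ r) : gridCeil n r ≤ r + 1 / (n + 1) := by
  rw [gridCeil, div_le_iff₀ (by positivity)]
  have := Nat.floor_le (show 0 ≤ r * (n + 1) by positivity)
  field_simp
  linarith

theorem gridCeil_pos (n : ℕ) (r : ℝ) : 0 < gridCeil n r := by
  unfold gridCeil; positivity

theorem measurable_gridCeil (n : ℕ) : Measurable (gridCeil n) := by
  unfold gridCeil
  have h : Measurable fun r : ℝ => ⌊r * (n + 1)⌋₊ :=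
    Nat.measurable_floor.comp (measurable_id.mul_const _)
  have h2 : Measurable fun k : ℕ => (k : ℝ) := .of_discrete
  exact ((h2.comp h).add_const _).div_const _

theorem tendsto_gridCeil {r : ℝ} (hr : 0 ≤ r) :
    Tendsto (fun n => gridCeil n r) atTop (𝓝 r) := by
  refine tendsto_of_tendsto_of_tendsto_of_le_of_le tendsto_const_nhds
    (by simpa using (tendsto_one_div_add_atTop_nhds_zero_nat (𝕜 := ℝ)).const_add r)
    (fun n => (lt_gridCeil n r).le) fun n => gridCeil_le n hr

section Nearest

variable {Ω : Type*} [MeasurableSpace Ω] {P : Measure Ω} [IsProbabilityMeasure P]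
  {X : ℕ → Ω → Plane} {lam : ℝ} {h : ℝ → ℝ} {α C : ℝ}

namespace IsPoissonProcess

/-- The event is the difference of the void events of the balls of radii `a` and `m`. The profile
vanishes on both balls, so on each void event the Laplace functional splits off the same constant.
-/
theorem setIntegral_servingDist_Ico (hX : IsPoissonProcess P X lam) (hlam : 0 ≤ lam) (hα : 2 < α)
    (hh : Measurable h) (h0 : ∀ v, 1 ≤ v → 0 ≤ h v) (hle : ∀ v, 1 ≤ v → h v ≤ C * v ^ (-α))
    {a m : ℝ} (ha : 0 ≤ a) (hm : 0 < m) (ham : a ≤ m) :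
    ∫ ω in {ω | a ≤ servingDist X ω ∧ servingDist X ω < m},
        Real.exp (-∑' j, outerProfile h m (X j ω)) ∂P =
      ∫ _ in {ω | a ≤ servingDist X ω ∧ servingDist X ω < m},
        Real.exp (-(lam * (Real.pi * m ^ 2 *
          (2 * ∫ v in Ioi (1 : ℝ), v * (1 - Real.exp (-h v)))))) ∂P := by
  have hRm := measurable_servingDist hX.measurable
  have hS : ∀ b, MeasurableSet {ω | b ≤ servingDist X ω} := fun b =>
    measurableSet_le measurable_const hRm
  have hpos := outerProfile_nonneg h0 hm
  have hFm : Measurable (outerProfile h m) :=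
    (measurable_outerProfile hh).comp measurable_prodMk_left
  have hF := integrable_outerProfile hα hh h0 hle hm
  have hset : {ω | a ≤ servingDist X ω ∧ servingDist X ω < m} =
      {ω | a ≤ servingDist X ω} \ {ω | m ≤ servingDist X ω} := by
    ext ω; simp
  have hsub : {ω | m ≤ servingDist X ω} ⊆ {ω | a ≤ servingDist X ω} :=
    fun ω hω => ham.trans hω
  have key : ∀ b, 0 ≤ b → b ≤ m → ∫ ω in {ω | b ≤ servingDist X ω},
      Real.exp (-∑' j, outerProfile h m (X j ω)) ∂P = P.real {ω | b ≤ servingDist X ω} *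
        Real.exp (-(lam * (Real.pi * m ^ 2 *
          (2 * ∫ v in Ioi (1 : ℝ), v * (1 - Real.exp (-h v)))))) := by
    intro b hb hbm
    rw [hX.measureReal_le_servingDist hlam hb, setOf_le_servingDist,
      hX.setIntegral_exp_neg_tsum hlam Metric.isOpen_ball.measurableSet measure_ball_lt_top.ne hF
        hFm hpos, volume_real_ball_plane hb, integral_one_sub_exp_outerProfile hm]
    intro x hx
    rw [mem_ball_zero_iff] at hx
    exact if_neg (not_le.2 (hx.trans_le hbm))
  have hint : Integrable (fun ω => Real.exp (-∑' j, outerProfile h m (X j ω))) P := by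
    refine (integrable_const (1 : ℝ)).mono' ?_ (.of_forall fun ω => ?_)
    · exact (measurable_real_tsum (fun j => hFm.comp (hX.measurable j))
        fun j ω => hpos _).neg.exp.aestronglyMeasurable
    · rw [Real.norm_of_nonneg (Real.exp_nonneg _), Real.exp_le_one_iff, neg_nonpos]
      exact tsum_nonneg fun j => hpos _
  rw [hset, setIntegral_sdiff (hS m) hint.integrableOn hsub, key a ha ham, key m hm.le le_rfl,
    setIntegral_const, measureReal_sdiff hsub (hS m), smul_eq_mul]
  ring

omit [IsProbabilityMeasure P] in
theorem measurable_tsum_outerProfile (hX : IsPoissonProcess P X lam) (hh : Measurable h)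
    (h0 : ∀ v, 1 ≤ v → 0 ≤ h v) {g : ℝ → ℝ} (hg : Measurable g) (hg0 : ∀ r, 0 < g r) :
    Measurable fun ω => ∑' j, outerProfile h (g (servingDist X ω)) (X j ω) :=
  measurable_real_tsum (f := fun j ω => outerProfile h (g (servingDist X ω)) (X j ω)) (fun j =>
    (measurable_outerProfile hh).comp
      ((hg.comp (measurable_servingDist hX.measurable)).prodMk (hX.measurable j)))
    fun _ _ => outerProfile_nonneg h0 (hg0 _) _

/-- On each grid cell of the nearest distance `gridCeil` is constant, so
`setIntegral_servingDist_Ico` applies cell by cell. -/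
theorem integral_gridCeil_servingDist (hX : IsPoissonProcess P X lam) (hlam : 0 ≤ lam) (hα : 2 < α)
    (hh : Measurable h) (h0 : ∀ v, 1 ≤ v → 0 ≤ h v) (hle : ∀ v, 1 ≤ v → h v ≤ C * v ^ (-α))
    {w : ℝ → ℝ} (hw : Measurable w) {B : ℝ} (hwB : ∀ r, ‖w r‖ ≤ B) (n : ℕ) :
    ∫ ω, w (gridCeil n (servingDist X ω)) *
        Real.exp (-∑' j, outerProfile h (gridCeil n (servingDist X ω)) (X j ω)) ∂P =
      ∫ ω, w (gridCeil n (servingDist X ω)) *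
        Real.exp (-(lam * (Real.pi * gridCeil n (servingDist X ω) ^ 2 *
          (2 * ∫ v in Ioi (1 : ℝ), v * (1 - Real.exp (-h v)))))) ∂P := by
  set κ := 2 * ∫ v in Ioi (1 : ℝ), v * (1 - Real.exp (-h v)) with hκ
  have hκ0 : 0 ≤ κ := mul_nonneg zero_le_two <| setIntegral_nonneg measurableSet_Ioi fun v hv =>
    mul_nonneg (zero_lt_one.trans (mem_Ioi.1 hv)).le
      (sub_nonneg.2 (Real.exp_le_one_iff.2 (neg_nonpos.2 (h0 v (mem_Ioi.1 hv).le))))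
  have hRm := measurable_servingDist hX.measurable
  have hwm : Measurable fun ω => w (gridCeil n (servingDist X ω)) :=
    hw.comp ((measurable_gridCeil n).comp hRm)
  have hi : ∀ u : Ω → ℝ, Measurable u → (∀ ω, 0 ≤ u ω) →
      Integrable (fun ω => w (gridCeil n (servingDist X ω)) * Real.exp (-u ω)) P := by
    intro u hu hu0
    refine (integrable_const B).mono' (hwm.mul hu.neg.exp).aestronglyMeasurable
      (.of_forall fun ω => ?_)
    rw [norm_mul, Real.norm_of_nonneg (Real.exp_nonneg _)]
    exact (mul_le_of_le_one_right (norm_nonneg _)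
      (Real.exp_le_one_iff.2 (neg_nonpos.2 (hu0 ω)))).trans (hwB _)
  have hi1 := hi _ (hX.measurable_tsum_outerProfile hh h0 (measurable_gridCeil n) (gridCeil_pos n))
    fun ω => tsum_nonneg fun j => outerProfile_nonneg h0 (gridCeil_pos n _) _
  have hi2 := hi (fun ω => lam * (Real.pi * gridCeil n (servingDist X ω) ^ 2 * κ))
    (((((measurable_gridCeil n).comp hRm).pow_const 2).const_mul _).mul_const _ |>.const_mul _)
    fun ω => by have := Real.pi_pos; positivity
  let s : ℕ → Set Ω := fun k => {ω | (k : ℝ) / (n + 1) ≤ servingDist X ω ∧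
    servingDist X ω < (k + 1) / (n + 1)}
  have hs_eq : ∀ k, s k = {ω | ⌊servingDist X ω * (n + 1)⌋₊ = k} := by
    intro k
    ext ω
    simp only [s, mem_ofPred_eq]
    rw [Nat.floor_eq_iff (mul_nonneg (servingDist_nonneg ω) (by positivity)),
      div_le_iff₀ (by positivity), lt_div_iff₀ (by positivity)]
  have hs : ∀ k, MeasurableSet (s k) := fun k =>
    (measurableSet_le measurable_const hRm).inter (measurableSet_lt hRm measurable_const)
  have hd : Pairwise (Function.onFun Disjoint s) := fun k l hkl => by
    rw [Function.onFun, hs_eq, hs_eq]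
    exact Set.disjoint_left.2 fun ω hk hl => hkl (Eq.trans (Eq.symm hk) hl)
  have hU : ⋃ k, s k = univ := eq_univ_of_forall fun ω => by
    simp_rw [hs_eq]
    simp
  have hgrid : ∀ k, ∀ ω ∈ s k, gridCeil n (servingDist X ω) = (k + 1) / (n + 1) := by
    intro k ω hω
    rw [hs_eq] at hω
    rw [gridCeil, show ⌊servingDist X ω * (n + 1)⌋₊ = k from hω]
  have hsplit : ∀ u : Ω → ℝ, Integrable u P → ∫ ω, u ω ∂P = ∑' k, ∫ ω in s k, u ω ∂P := by
    intro u hu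
    rw [← setIntegral_univ, ← hU, integral_iUnion hs hd hu.integrableOn]
  rw [hsplit _ hi1, hsplit _ hi2]
  refine tsum_congr fun k => ?_
  calc ∫ ω in s k, w (gridCeil n (servingDist X ω)) *
        Real.exp (-∑' j, outerProfile h (gridCeil n (servingDist X ω)) (X j ω)) ∂P
      = ∫ ω in s k, w ((k + 1) / (n + 1)) *
        Real.exp (-∑' j, outerProfile h ((k + 1) / (n + 1)) (X j ω)) ∂P :=
        setIntegral_congr_fun (hs k) fun ω hω => by simp only [hgrid k ω hω]
    _ = ∫ _ in s k, w ((k + 1) / (n + 1)) *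
        Real.exp (-(lam * (Real.pi * ((k + 1) / (n + 1)) ^ 2 * κ))) ∂P := by
        rw [integral_const_mul, integral_const_mul,
          hX.setIntegral_servingDist_Ico hlam hα hh h0 hle (by positivity) (by positivity)
            (by gcongr; linarith)]
    _ = _ := setIntegral_congr_fun (hs k) fun ω hω => by simp only [hgrid k ω hω]

/-- The radius is quantified inside the almost sure statement because it will be random. Countably
many radii suffice, since a smaller excluded ball gives a larger sum. -/
theorem summable_outside (hX : IsPoissonProcess P X lam) (hlam : 0 ≤ lam) (hα : 2 < α) :
    ∀ᵐ ω ∂P, ∀ r, 0 < r → Summable fun j => if r ≤ ‖X j ω‖ then ‖X j ω‖ ^ (-α) else 0 := by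
  have h1 : ∀ n : ℕ, ∀ᵐ ω ∂P,
      Summable fun j => if 1 / ((n : ℝ) + 1) ≤ ‖X j ω‖ then ‖X j ω‖ ^ (-α) else 0 := fun n =>
    hX.ae_summable hlam (F := fun x => if 1 / ((n : ℝ) + 1) ≤ ‖x‖ then ‖x‖ ^ (-α) else 0)
      (integrable_rpow_outside hα (by positivity))
      (Measurable.ite (measurableSet_le measurable_const measurable_norm)
        (measurable_norm.pow_const _) measurable_const)
      fun x => by split_ifs <;> positivity
  filter_upwards [ae_all_iff.2 h1] with ω hω r hr
  obtain ⟨n, hn⟩ := exists_nat_one_div_lt hr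
  refine (hω n).of_nonneg_of_le (fun j => by split_ifs <;> positivity) fun j => ?_
  split_ifs with h2 h3
  · exact le_rfl
  · exact absurd (hn.le.trans h2) h3
  · positivity
  · exact le_rfl

/-- Given the distance `R` to the nearest point, the other points form a Poisson process outside
the ball of radius `R`. -/
theorem integral_servingDist_exp (hX : IsPoissonProcess P X lam) (hlam : 0 < lam) (hα : 2 < α)
    (hC : 0 ≤ C)
    (hh : Measurable h) (hcont : ContinuousOn h (Ici 1)) (h0 : ∀ v, 1 ≤ v → 0 ≤ h v)
    (hle : ∀ v, 1 ≤ v → h v ≤ C * v ^ (-α))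
    {w : ℝ → ℝ} (hw : Continuous w) {B : ℝ} (hwB : ∀ r, ‖w r‖ ≤ B) :
    ∫ ω, w (servingDist X ω) * Real.exp (-∑' j, if servingDist X ω < ‖X j ω‖ then
        h (‖X j ω‖ / servingDist X ω) else 0) ∂P =
      ∫ ω, w (servingDist X ω) * Real.exp (-(lam * (Real.pi * servingDist X ω ^ 2 *
          (2 * ∫ v in Ioi (1 : ℝ), v * (1 - Real.exp (-h v)))))) ∂P := by
  set κ := 2 * ∫ v in Ioi (1 : ℝ), v * (1 - Real.exp (-h v)) with hκ
  have hκ0 : 0 ≤ κ := mul_nonneg zero_le_two <| setIntegral_nonneg measurableSet_Ioi fun v hv =>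
    mul_nonneg (zero_lt_one.trans (mem_Ioi.1 hv)).le
      (sub_nonneg.2 (Real.exp_le_one_iff.2 (neg_nonpos.2 (h0 v (mem_Ioi.1 hv).le))))
  have hRm := measurable_servingDist hX.measurable
  have hwm : ∀ n, Measurable fun ω => w (gridCeil n (servingDist X ω)) := fun n =>
    hw.measurable.comp ((measurable_gridCeil n).comp hRm)
  have hbd : ∀ r u : ℝ, 0 ≤ u → ‖w r * Real.exp (-u)‖ ≤ B := by
    intro r u hu
    rw [norm_mul, Real.norm_of_nonneg (Real.exp_nonneg _)]
    exact (mul_le_of_le_one_right (norm_nonneg _)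
      (Real.exp_le_one_iff.2 (neg_nonpos.2 hu))).trans (hwB _)
  have hwt : ∀ ω, Tendsto (fun n => w (gridCeil n (servingDist X ω))) atTop
      (𝓝 (w (servingDist X ω))) := fun ω =>
    (hw.tendsto _).comp (tendsto_gridCeil (servingDist_nonneg ω))
  have hL : Tendsto (fun n => ∫ ω, w (gridCeil n (servingDist X ω)) *
      Real.exp (-∑' j, outerProfile h (gridCeil n (servingDist X ω)) (X j ω)) ∂P) atTop
      (𝓝 (∫ ω, w (servingDist X ω) * Real.exp (-∑' j, if servingDist X ω < ‖X j ω‖ then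
        h (‖X j ω‖ / servingDist X ω) else 0) ∂P)) := by
    refine tendsto_integral_of_dominated_convergence (fun _ => B) (fun n => ?_)
      (integrable_const _) (fun n => .of_forall fun ω => ?_) ?_
    · exact ((hwm n).mul (hX.measurable_tsum_outerProfile hh h0 (measurable_gridCeil n)
        (gridCeil_pos n)).neg.exp).aestronglyMeasurable
    · exact hbd _ _ (tsum_nonneg fun j => outerProfile_nonneg h0 (gridCeil_pos n _) _)
    · filter_upwards [hX.summable_outside hlam.le hα, hX.ae_servingDist_pos hlam] with ω hsum hR
      set R := servingDist X ω
      refine (hwt ω).mul ((Real.continuous_exp.tendsto _).comp (Tendsto.neg ?_))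
      -- As `gridCeil n R` lies between `R` and `R + 1`, one summable bound serves every grid.
      refine tendsto_tsum_of_dominated_convergence
        (bound := fun j => C * (R + 1) ^ α * if R ≤ ‖X j ω‖ then ‖X j ω‖ ^ (-α) else 0)
        ((hsum R hR).mul_left _) (fun j => ?_) (.of_forall fun n j => ?_)
      · unfold outerProfile
        have ht := tendsto_gridCeil hR.le
        split_ifs with hj
        · have h1 : ∀ᶠ n in atTop, gridCeil n R ≤ ‖X j ω‖ := ht.eventually_le_const hj
          have h2 : Tendsto (fun n => h (‖X j ω‖ / gridCeil n R)) atTop (𝓝 (h (‖X j ω‖ / R))) := by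
            have hc : Tendsto h (𝓝[Ici 1] (‖X j ω‖ / R)) (𝓝 (h (‖X j ω‖ / R))) :=
              hcont _ ((one_le_div hR).2 hj.le)
            refine hc.comp (tendsto_nhdsWithin_iff.2
              ⟨tendsto_const_nhds.div ht hR.ne', h1.mono fun n hn => ?_⟩)
            exact (one_le_div (gridCeil_pos n R)).2 hn
          exact h2.congr' (h1.mono fun n hn => (if_pos hn).symm)
        -- `gridCeil` is strictly above `R`, so every point at distance at most `R`, the nearest one
        -- included, is excluded at each stage; possible ties need no argument.
        · refine tendsto_const_nhds.congr fun n => (if_neg ?_).symm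
          exact not_le.2 ((not_lt.1 hj).trans_lt (lt_gridCeil n R))
      · rw [Real.norm_of_nonneg (outerProfile_nonneg h0 (gridCeil_pos n _) _)]
        refine (outerProfile_le hle (gridCeil_pos n _) _).trans ?_
        have hg1 : gridCeil n R ≤ R + 1 := (gridCeil_le n hR.le).trans (by
          gcongr
          rw [div_le_one (by positivity)]
          linarith [show (0 : ℝ) ≤ n from n.cast_nonneg])
        have hg2 : (if gridCeil n R ≤ ‖X j ω‖ then ‖X j ω‖ ^ (-α) else 0) ≤
            if R ≤ ‖X j ω‖ then ‖X j ω‖ ^ (-α) else 0 := by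
          split_ifs with h2 h3
          · exact le_rfl
          · exact absurd ((lt_gridCeil n R).le.trans h2) h3
          · positivity
          · exact le_rfl
        have hg3 := (gridCeil_pos n R).le
        gcongr
  have hR : Tendsto (fun n => ∫ ω, w (gridCeil n (servingDist X ω)) *
      Real.exp (-(lam * (Real.pi * gridCeil n (servingDist X ω) ^ 2 * κ))) ∂P) atTop
      (𝓝 (∫ ω, w (servingDist X ω) *
        Real.exp (-(lam * (Real.pi * servingDist X ω ^ 2 * κ))) ∂P)) := by
    refine tendsto_integral_of_dominated_convergence (fun _ => B) (fun n => ?_)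
      (integrable_const _) (fun n => .of_forall fun ω => ?_) (.of_forall fun ω => ?_)
    · exact ((hwm n).mul (((((measurable_gridCeil n).comp hRm).pow_const 2).const_mul _).mul_const _
        |>.const_mul _).neg.exp).aestronglyMeasurable
    · exact hbd _ _ (by have := Real.pi_pos; positivity)
    · refine (hwt ω).mul ((Real.continuous_exp.tendsto _).comp (Tendsto.neg ?_))
      exact ((((tendsto_gridCeil (servingDist_nonneg ω)).pow 2).const_mul _).mul_const _).const_mul _
  refine tendsto_nhds_unique hL (hR.congr fun n => ?_)
  exact (hX.integral_gridCeil_servingDist hlam.le hα hh h0 hle hw.measurable hwB n).symm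

end IsPoissonProcess

end Nearest

/-! ### Euler's integral as the continuation of the Gauss series -/

theorem integrableOn_rpow_sub_one {b : ℝ} (hb : 0 < b) :
    IntegrableOn (fun s : ℝ => s ^ (b - 1)) (Ioo 0 1) :=
  (intervalIntegral.integrableOn_Ioo_rpow_iff zero_lt_one).2 (by linarith)

theorem integral_rpow_Ioo {b : ℝ} (hb : 0 < b) (n : ℕ) :
    ∫ s in Ioo (0 : ℝ) 1, s ^ (b - 1) * s ^ n = 1 / (b + n) := by
  have h1 : ∫ s in Ioo (0 : ℝ) 1, s ^ (b - 1) * s ^ n = ∫ s in Ioo (0 : ℝ) 1, s ^ (b - 1 + n) :=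
    setIntegral_congr_fun measurableSet_Ioo fun s hs => by
      simp only [Real.rpow_add hs.1, Real.rpow_natCast]
  rw [h1, ← integral_Ioc_eq_integral_Ioo, ← intervalIntegral.integral_of_le zero_le_one,
    integral_rpow (Or.inl (by have := n.cast_nonneg (α := ℝ); linarith)), Real.one_rpow,
    Real.zero_rpow (by have := n.cast_nonneg (α := ℝ); linarith)]
  ring_nf

/-- Euler's integral for `₂F₁(1, b; b + 1; z)`. -/
noncomputable def eulerIntegral (b z : ℝ) : ℝ :=
  b * ∫ s in Ioo (0 : ℝ) 1, s ^ (b - 1) * (1 - z * s)⁻¹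

/-- Differentiation under the integral sign on a half-plane `re z < c` with `c < 1`, where `1 - z *
s` stays at distance at least `1 - c` from zero. Complex differentiability is what yields
analyticity. -/
theorem eulerIntegral_complex_differentiableAt {b : ℝ} (hb : 0 < b) {z₀ : ℂ} (hz₀ : z₀.re < 1) :
    DifferentiableAt ℂ (fun z : ℂ => ∫ s in Ioo (0 : ℝ) 1,
      ((s ^ (b - 1) : ℝ) : ℂ) * (1 - z * s)⁻¹) z₀ := by
  -- The midpoint of `z₀.re` and `1`, raised to be non-negative so that `z.re * s ≤ c` for all `s`
  -- in `(0, 1)`.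
  obtain ⟨c, hc0, hc1, hzc⟩ : ∃ c : ℝ, 0 ≤ c ∧ c < 1 ∧ z₀.re < c :=
    ⟨max 0 ((1 + z₀.re) / 2), le_max_left _ _, max_lt one_pos (by linarith),
      lt_max_of_lt_right (by linarith)⟩
  have hlow : ∀ z : ℂ, z.re < c → ∀ s ∈ Ioo (0 : ℝ) 1, 1 - c ≤ ‖1 - z * s‖ := by
    intro z hz s hs
    refine le_trans ?_ ((le_abs_self _).trans (Complex.abs_re_le_norm _))
    have : z.re * s ≤ c := by nlinarith [hs.1, hs.2]
    rw [Complex.sub_re, Complex.one_re, Complex.re_mul_ofReal]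
    linarith
  have hne : ∀ z : ℂ, z.re < c → ∀ s ∈ Ioo (0 : ℝ) 1, 1 - z * s ≠ 0 := by
    intro z hz s hs h0
    have := hlow z hz s hs
    rw [h0, norm_zero] at this
    linarith
  have hmeas : ∀ z : ℂ, Measurable fun s : ℝ => ((s ^ (b - 1) : ℝ) : ℂ) * (1 - z * s)⁻¹ := by
    intro z; fun_prop
  have hU : {z : ℂ | z.re < c} ∈ 𝓝 z₀ :=
    (isOpen_lt Complex.continuous_re continuous_const).mem_nhds hzc
  have hw := integrableOn_rpow_sub_one hb
  have hnorm : ∀ s ∈ Ioo (0 : ℝ) 1, ‖((s ^ (b - 1) : ℝ) : ℂ)‖ = s ^ (b - 1) := fun s hs => by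
    rw [Complex.norm_real, Real.norm_of_nonneg (Real.rpow_nonneg hs.1.le _)]
  have hinv : ∀ z : ℂ, z.re < c → ∀ s ∈ Ioo (0 : ℝ) 1, ‖(1 - z * s)⁻¹‖ ≤ (1 - c)⁻¹ :=
    fun z hz s hs => by
      rw [norm_inv]
      exact inv_anti₀ (by linarith) (hlow z hz s hs)
  refine (hasDerivAt_integral_of_dominated_loc_of_deriv_le
    (μ := volume.restrict (Ioo (0 : ℝ) 1)) (s := {z : ℂ | z.re < c})
    (F := fun (z : ℂ) (s : ℝ) => ((s ^ (b - 1) : ℝ) : ℂ) * (1 - z * s)⁻¹)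
    (F' := fun (z : ℂ) (s : ℝ) => ((s ^ (b - 1) : ℝ) : ℂ) * (s * ((1 - z * s)⁻¹ * (1 - z * s)⁻¹)))
    (bound := fun s => s ^ (b - 1) * ((1 - c)⁻¹ * (1 - c)⁻¹))
    hU (.of_forall fun z => (hmeas z).aestronglyMeasurable) ?_ ?_ ?_ (hw.mul_const _)
    ?_).2.differentiableAt
  · refine (hw.mul_const (1 - c)⁻¹).mono' (hmeas z₀).aestronglyMeasurable ?_
    filter_upwards [ae_restrict_mem measurableSet_Ioo] with s hs
    rw [norm_mul, hnorm s hs]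
    exact mul_le_mul_of_nonneg_left (hinv z₀ hzc s hs) (Real.rpow_nonneg hs.1.le _)
  · exact (show Measurable _ by fun_prop).aestronglyMeasurable
  · filter_upwards [ae_restrict_mem measurableSet_Ioo] with s hs z hz
    rw [norm_mul, hnorm s hs, norm_mul, norm_mul, Complex.norm_real, Real.norm_of_nonneg hs.1.le]
    refine mul_le_mul_of_nonneg_left ?_ (Real.rpow_nonneg hs.1.le _)
    refine (mul_le_of_le_one_left (by positivity) hs.2.le).trans ?_
    have := hinv z hz s hs
    gcongr
  · filter_upwards [ae_restrict_mem measurableSet_Ioo] with s hs z hz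
    have h1 : HasDerivAt (fun z : ℂ => 1 - z * s) (-s : ℂ) z := by
      simpa using ((hasDerivAt_id z).mul_const (s : ℂ)).const_sub 1
    have h2 := (h1.inv (hne z hz s hs)).const_mul ((s ^ (b - 1) : ℝ) : ℂ)
    refine h2.congr_deriv ?_
    rw [neg_neg, div_eq_mul_inv, pow_two, mul_inv]

/-- On the real axis Euler's integral is `b` times the real part of a holomorphic function. -/
theorem analyticOnNhd_eulerIntegral {b : ℝ} (hb : 0 < b) :
    AnalyticOnNhd ℝ (eulerIntegral b) (Iio 1) := by
  intro x hx
  have hopen : IsOpen {z : ℂ | z.re < 1} := isOpen_lt Complex.continuous_re continuous_const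
  have hd : DifferentiableOn ℂ (fun z : ℂ => ∫ s in Ioo (0 : ℝ) 1,
      ((s ^ (b - 1) : ℝ) : ℂ) * (1 - z * s)⁻¹) {z : ℂ | z.re < 1} := fun z hz =>
    (eulerIntegral_complex_differentiableAt hb hz).differentiableWithinAt
  have ha := hd.analyticAt (hopen.mem_nhds (show (x : ℂ) ∈ {z : ℂ | z.re < 1} by simpa using hx))
  have h2 := (Complex.reCLM.analyticAt _).comp
    (ha.restrictScalars (𝕜 := ℝ) |>.comp (f := fun y : ℝ => (y : ℂ)) (Complex.ofRealCLM.analyticAt x))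
  have h3 : eulerIntegral b = fun y : ℝ => b * Complex.reCLM (∫ s in Ioo (0 : ℝ) 1,
      ((s ^ (b - 1) : ℝ) : ℂ) * (1 - (y : ℂ) * s)⁻¹) := by
    ext y
    rw [eulerIntegral]
    congr 1
    have : ∀ s : ℝ, ((s ^ (b - 1) : ℝ) : ℂ) * (1 - (y : ℂ) * s)⁻¹ =
        ((s ^ (b - 1) * (1 - y * s)⁻¹ : ℝ) : ℂ) := fun s => by push_cast; rfl
    simp_rw [this]
    rw [integral_complex_ofReal]
    simp
  rw [h3]
  exact analyticAt_const.mul h2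

theorem ascPochhammer_eval_mul_add (b : ℝ) (n : ℕ) :
    (ascPochhammer ℝ n).eval b * (b + n) = b * (ascPochhammer ℝ n).eval (b + 1) := by
  induction n with
  | zero => simp
  | succ n ih =>
    rw [ascPochhammer_succ_eval, ascPochhammer_succ_eval, ih]
    push_cast
    ring

/-- The Pochhammer symbol of `1` cancels the factorial, and those of `b` and `b + 1` have quotient
`b / (b + n)`. -/
theorem ordinaryHypergeometric_one_eq_tsum {b : ℝ} (hb : 0 < b) (z : ℝ) :
    ordinaryHypergeometric 1 b (b + 1) z = ∑' n : ℕ, b / (b + n) * z ^ n := by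
  rw [ordinaryHypergeometric_eq_tsum]
  refine tsum_congr fun n => ?_
  have h1 := ascPochhammer_eval_mul_add b n
  have h2 : (ascPochhammer ℝ n).eval (b + 1) ≠ 0 := (ascPochhammer_pos n _ (by linarith)).ne'
  have h3 : (n ! : ℝ) ≠ 0 := by positivity
  have h4 : b + n ≠ 0 := by positivity
  rw [ascPochhammer_eval_one, smul_eq_mul]
  congr 1
  field_simp
  linarith

/-- The geometric series for `(1 - z * s)⁻¹`, integrated term by term. -/
theorem eulerIntegral_eq_tsum {b : ℝ} (hb : 0 < b) {z : ℝ} (hz : |z| < 1) :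
    eulerIntegral b z = ∑' n : ℕ, b / (b + n) * z ^ n := by
  have hw := integrableOn_rpow_sub_one hb
  have hint : ∀ n : ℕ, IntegrableOn (fun s : ℝ => s ^ (b - 1) * (z * s) ^ n) (Ioo 0 1) := by
    intro n
    refine hw.mono' (show Measurable _ by fun_prop).aestronglyMeasurable ?_
    filter_upwards [ae_restrict_mem measurableSet_Ioo] with s hs
    rw [norm_mul, Real.norm_of_nonneg (Real.rpow_nonneg hs.1.le _), norm_pow, Real.norm_eq_abs,
      abs_mul, abs_of_pos hs.1]
    refine mul_le_of_le_one_right (Real.rpow_nonneg hs.1.le _) (pow_le_one₀ ?_ ?_)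
    · exact mul_nonneg (abs_nonneg _) hs.1.le
    · exact mul_le_one₀ hz.le hs.1.le hs.2.le
  have hval : ∀ (x : ℝ) (n : ℕ), ∫ s in Ioo (0 : ℝ) 1, s ^ (b - 1) * (x * s) ^ n =
      1 / (b + n) * x ^ n := by
    intro x n
    rw [← integral_rpow_Ioo hb n, ← integral_mul_const]
    refine integral_congr_ae (.of_forall fun s => ?_)
    simp only [mul_pow]
    ring
  have hsum : Summable fun n : ℕ => ∫ s in Ioo (0 : ℝ) 1, ‖s ^ (b - 1) * (z * s) ^ n‖ := by
    have h1 : ∀ n : ℕ, ∫ s in Ioo (0 : ℝ) 1, ‖s ^ (b - 1) * (z * s) ^ n‖ =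
        1 / (b + n) * |z| ^ n := by
      intro n
      rw [← hval]
      refine setIntegral_congr_fun measurableSet_Ioo fun s hs => ?_
      simp only [norm_mul, Real.norm_of_nonneg (Real.rpow_nonneg hs.1.le _), norm_pow,
        Real.norm_eq_abs, abs_of_pos hs.1]
    simp_rw [h1]
    refine ((summable_geometric_of_lt_one (abs_nonneg z) hz).mul_left (1 / b)).of_nonneg_of_le
      (fun n => by positivity) fun n => ?_
    gcongr
    linarith [n.cast_nonneg (α := ℝ)]
  have h := hasSum_integral_of_summable_integral_norm (fun n => (hint n).integrable) hsum
  have h2 : ∫ s in Ioo (0 : ℝ) 1, ∑' n : ℕ, s ^ (b - 1) * (z * s) ^ n =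
      ∫ s in Ioo (0 : ℝ) 1, s ^ (b - 1) * (1 - z * s)⁻¹ := by
    refine setIntegral_congr_fun measurableSet_Ioo fun s hs => ?_
    rw [tsum_mul_left, tsum_geometric_of_abs_lt_one]
    rw [abs_mul, abs_of_pos hs.1]
    exact (mul_le_of_le_one_right (abs_nonneg z) hs.2.le).trans_lt hz
  rw [eulerIntegral, ← h2, ← h.tsum_eq, ← tsum_mul_left]
  refine tsum_congr fun n => ?_
  rw [hval]
  ring

theorem isGaussContinuation_eulerIntegral {b : ℝ} (hb : 0 < b) :
    IsGaussContinuation 1 b (b + 1) (eulerIntegral b) where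
  analytic := analyticOnNhd_eulerIntegral hb
  eq_series z hz := by
    rw [ordinaryHypergeometric_one_eq_tsum hb, eulerIntegral_eq_tsum hb (abs_lt.2 hz)]

/-! ### Integral form and growth of `rho` -/

section Rho

variable {α : ℝ}

theorem rho_eq_eulerIntegral (hα : 2 < α) {T : ℝ} (hT : 0 ≤ T) :
    rho T α = 2 * T / (α - 2) * eulerIntegral (1 - 2 / α) (-T) := by
  have hb : 0 < 1 - 2 / α := by
    rw [sub_pos, div_lt_one (by linarith)]; exact hα
  have h := (isGaussContinuation_eulerIntegral hb).gaussHypergeometric_eq (z := -T) (by linarith)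
  rw [rho, ← h]
  congr 2
  ring

theorem continuousOn_rho (hα : 2 < α) : ContinuousOn (fun T => rho T α) (Ici 0) := by
  have hb : 0 < 1 - 2 / α := by
    rw [sub_pos, div_lt_one (by linarith)]; exact hα
  have h1 : ContinuousOn (fun T : ℝ => 2 * T / (α - 2) * eulerIntegral (1 - 2 / α) (-T))
      (Ici 0) := by
    refine ContinuousOn.mul (by fun_prop) ?_
    refine (analyticOnNhd_eulerIntegral hb).continuousOn.comp continuousOn_neg fun T hT => ?_
    have : 0 ≤ T := hT
    simp only [mem_Iio]
    linarith
  exact h1.congr fun T hT => rho_eq_eulerIntegral hα hT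

/-- Substitute `s = v ^ (-α)` in Euler's integral: `(0, 1)` becomes `v > 1`, and the constants `1 -
2 / α`, `α` and `1 / (α - 2)` cancel. In this form `rho` is the exponent of a Laplace functional. -/
theorem rho_eq_integral (hα : 2 < α) {T : ℝ} (hT : 0 ≤ T) :
    rho T α = 2 * ∫ v in Ioi (1 : ℝ), v * (T * v ^ (-α) / (1 + T * v ^ (-α))) := by
  have hα0 : 0 < α := by linarith
  set g : ℝ → ℝ := (Ioo (0 : ℝ) 1).indicator
    fun s => s ^ ((1 - 2 / α) - 1) * (1 - -T * s)⁻¹ with hg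
  have h1 := integral_comp_rpow_Ioi g (neg_ne_zero.2 hα0.ne')
  have h2 : ∫ s in Ioi (0 : ℝ), g s = ∫ s in Ioo (0 : ℝ) 1,
      s ^ ((1 - 2 / α) - 1) * (1 - -T * s)⁻¹ := by
    rw [hg, setIntegral_indicator measurableSet_Ioo, inter_eq_right.2 Ioo_subset_Ioi_self]
  have h3 : ∫ x in Ioi (0 : ℝ), (|-α| * x ^ (-α - 1)) • g (x ^ (-α)) =
      ∫ x in Ioi (0 : ℝ), (Ioi (1 : ℝ)).indicator
        (fun v => α * (v * (v ^ (-α) / (1 + T * v ^ (-α))))) x := by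
    refine setIntegral_congr_fun measurableSet_Ioi fun x hx => ?_
    have hx0 : (0 : ℝ) < x := hx
    by_cases hx1 : 1 < x
    · have hm : x ^ (-α) ∈ Ioo (0 : ℝ) 1 :=
        ⟨Real.rpow_pos_of_pos hx0 _, Real.rpow_lt_one_of_one_lt_of_neg hx1 (by linarith)⟩
      simp only [hg, indicator_of_mem hm, indicator_of_mem (mem_Ioi.2 hx1), smul_eq_mul]
      rw [abs_neg, abs_of_pos hα0, ← Real.rpow_mul hx0.le, Real.rpow_sub_one hx0.ne',
        show -α * (1 - 2 / α - 1) = (2 : ℕ) by push_cast; field_simp; ring, Real.rpow_natCast]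
      have : 0 < 1 + T * x ^ (-α) := by have := hm.1; positivity
      rw [neg_mul, sub_neg_eq_add]
      field_simp
    · have hm : x ^ (-α) ∉ Ioo (0 : ℝ) 1 := fun h => by
        have := Real.one_le_rpow_of_pos_of_le_one_of_nonpos hx0 (not_lt.1 hx1)
          (show -α ≤ 0 by linarith)
        exact absurd h.2 (not_lt.2 this)
      simp only [hg, indicator_of_notMem hm, indicator_of_notMem (show x ∉ Ioi (1 : ℝ) from hx1),
        smul_zero]
  rw [rho_eq_eulerIntegral hα hT, eulerIntegral, ← h2, ← h1, h3,
    setIntegral_indicator measurableSet_Ioi,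
    inter_eq_right.2 (Ioi_subset_Ioi zero_le_one), integral_const_mul]
  have h4 : ∫ v in Ioi (1 : ℝ), v * (T * v ^ (-α) / (1 + T * v ^ (-α))) =
      T * ∫ v in Ioi (1 : ℝ), v * (v ^ (-α) / (1 + T * v ^ (-α))) := by
    rw [← integral_const_mul]
    refine integral_congr_ae (.of_forall fun v => ?_)
    simp only
    ring
  rw [h4]
  have : α - 2 ≠ 0 := by linarith
  field_simp

theorem rho_nonneg (hα : 2 < α) {T : ℝ} (hT : 0 ≤ T) : 0 ≤ rho T α := by
  rw [rho_eq_integral hα hT]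
  refine mul_nonneg zero_le_two (setIntegral_nonneg measurableSet_Ioi fun v hv => ?_)
  have : (0 : ℝ) < v := zero_lt_one.trans hv
  positivity

theorem integrableOn_rho (hα : 2 < α) {T : ℝ} (hT : 0 ≤ T) :
    IntegrableOn (fun v : ℝ => v * (T * v ^ (-α) / (1 + T * v ^ (-α)))) (Ioi 1) := by
  have h1 : IntegrableOn (fun v : ℝ => T * v ^ (1 - α)) (Ioi 1) :=
    (integrableOn_Ioi_rpow_of_lt (by linarith) one_pos).const_mul T
  refine h1.mono' (show Measurable _ by fun_prop).aestronglyMeasurable ?_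
  filter_upwards [ae_restrict_mem measurableSet_Ioi] with v hv
  have hv0 : (0 : ℝ) < v := zero_lt_one.trans hv
  have hp : 0 < v ^ (-α) := Real.rpow_pos_of_pos hv0 _
  rw [Real.norm_of_nonneg (by positivity), sub_eq_add_neg, Real.rpow_add hv0, Real.rpow_one]
  calc v * (T * v ^ (-α) / (1 + T * v ^ (-α))) ≤ v * (T * v ^ (-α)) := by
        gcongr
        exact div_le_self (by positivity) (by linarith [mul_nonneg hT hp.le])
    _ = _ := by ring

/-- For `v ≤ T ^ (1 / α)` the fraction is at least `1 / 2`, so the integral is at least that of `v /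
2` up to this point. -/
theorem le_rho (hα : 2 < α) {T : ℝ} (hT : 0 ≤ T) : (T ^ (2 / α) - 1) / 2 ≤ rho T α := by
  have hα0 : 0 < α := by linarith
  rcases le_total T 1 with hT1 | hT1
  · have := rho_nonneg hα hT
    have := Real.rpow_le_one hT hT1 (show 0 ≤ 2 / α by positivity)
    linarith
  · set L := T ^ (1 / α)
    have hL : 1 ≤ L := Real.one_le_rpow hT1 (by positivity)
    have hL2 : L ^ 2 = T ^ (2 / α) := by
      rw [← Real.rpow_natCast, ← Real.rpow_mul hT]
      congr 1
      push_cast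
      ring
    have hnn : ∀ v ∈ Ioi (1 : ℝ), 0 ≤ v * (T * v ^ (-α) / (1 + T * v ^ (-α))) := fun v hv => by
      have : (0 : ℝ) < v := zero_lt_one.trans hv
      positivity
    have h1 : ∫ v in (1 : ℝ)..L, v / 2 ≤
        ∫ v in Ioi (1 : ℝ), v * (T * v ^ (-α) / (1 + T * v ^ (-α))) := by
      rw [intervalIntegral.integral_of_le hL]
      refine le_trans ?_ (setIntegral_mono_set (integrableOn_rho hα hT)
        (ae_restrict_of_forall_mem measurableSet_Ioi hnn)
        (show Ioc 1 L ⊆ Ioi 1 from Ioc_subset_Ioi_self).eventuallyLE)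
      refine setIntegral_mono_on ?_ ((integrableOn_rho hα hT).mono_set Ioc_subset_Ioi_self)
        measurableSet_Ioc fun v hv => ?_
      · exact (continuous_id.div_const 2).integrableOn_Ioc
      · have hv0 : 0 < v := zero_lt_one.trans hv.1
        have h2 : 1 ≤ T * v ^ (-α) := by
          rw [Real.rpow_neg hv0.le, ← div_eq_mul_inv, one_le_div (by positivity)]
          calc v ^ α ≤ L ^ α := Real.rpow_le_rpow hv0.le hv.2 hα0.le
            _ = T := by
              rw [← Real.rpow_mul hT, one_div_mul_cancel hα0.ne', Real.rpow_one]
        rw [div_eq_mul_inv]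
        refine mul_le_mul_of_nonneg_left ?_ hv0.le
        rw [inv_eq_one_div, div_le_div_iff₀ two_pos (by linarith)]
        linarith
    rw [intervalIntegral.integral_div, integral_id, hL2] at h1
    rw [rho_eq_integral hα hT]
    linarith

/-- Exponential lower bound for the denominator of the coverage probability. -/
theorem le_mul_rho_add_one (hα : 2 < α) {q : ℝ} (hq : 0 < q) (hq1 : q ≤ 1) {t : ℝ} (ht : 0 ≤ t) :
    q / 2 * 2 ^ (2 / α * t) ≤ q * rho (2 ^ t - 1) α + 1 := by
  have hT : (0 : ℝ) ≤ 2 ^ t - 1 := sub_nonneg.2 (Real.one_le_rpow one_le_two ht)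
  have h1 := le_rho hα hT
  -- Subadditivity of the power `2 / α ≤ 1`, applied to `2 ^ t = 1 + (2 ^ t - 1)`.
  have h2 : ((2 : ℝ) ^ t) ^ (2 / α) ≤ 1 + (2 ^ t - 1) ^ (2 / α) := by
    have := Real.rpow_add_le_add_rpow (p := 2 / α) zero_le_one hT (by positivity)
      ((div_le_one (by linarith)).2 hα.le)
    simpa using this
  rw [mul_comm (2 / α), Real.rpow_mul zero_le_two]
  nlinarith

end Rho

/-! ### The exponential law, and Fubini for independent variables -/

theorem integral_expMeasure {r : ℝ} (hr : 0 < r) (u : ℝ → ℝ) :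
    ∫ x, u x ∂(expMeasure r) = ∫ x in Ioi (0 : ℝ), r * Real.exp (-(r * x)) * u x := by
  change ∫ x, u x ∂(volume.withDensity (exponentialPDF r)) = _
  rw [integral_withDensity_eq_integral_toReal_smul (f := exponentialPDF r)
    (measurable_exponentialPDFReal r).ennreal_ofReal (.of_forall fun x => ENNReal.ofReal_lt_top),
    ← integral_indicator measurableSet_Ioi]
  refine integral_congr_ae ?_
  filter_upwards [Measure.ae_ne volume (0 : ℝ)] with x hx
  rcases lt_or_gt_of_ne hx with h | h
  · rw [indicator_of_notMem (by simpa using h.le), exponentialPDF_of_neg h]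
    simp
  · rw [indicator_of_mem (by exact h), exponentialPDF_of_nonneg h.le,
      ENNReal.toReal_ofReal (by positivity), smul_eq_mul]

theorem expMeasure_real_Ioi {y : ℝ} (hy : 0 ≤ y) :
    (expMeasure 1).real (Ioi y) = Real.exp (-y) := by
  have := isProbabilityMeasure_expMeasure one_pos
  rw [← compl_Iic, probReal_compl_eq_one_sub measurableSet_Iic, ← cdf_eq_real,
    cdf_expMeasure_eq one_pos, if_pos hy]
  simp

theorem ae_nonneg_expMeasure : ∀ᵐ x ∂(expMeasure 1), 0 ≤ x := by
  have := isProbabilityMeasure_expMeasure one_pos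
  have h1 : ∀ᵐ x ∂(expMeasure 1), x ∈ Ioi (0 : ℝ) := by
    refine (mem_ae_iff_prob_eq_one₀ measurableSet_Ioi.nullMeasurableSet).2 ?_
    rw [← ENNReal.toReal_eq_one_iff]
    exact (expMeasure_real_Ioi le_rfl).trans (by simp)
  exact h1.mono fun x hx => le_of_lt hx

theorem integral_exp_neg_mul_toNNReal_expMeasure {a : ℝ} (ha : 0 ≤ a) :
    ∫ x, Real.exp (-(a * (x.toNNReal : ℝ))) ∂(expMeasure 1) = 1 / (1 + a) := by
  rw [integral_expMeasure one_pos]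
  have h1 : ∫ x in Ioi (0 : ℝ), 1 * Real.exp (-(1 * x)) * Real.exp (-(a * (x.toNNReal : ℝ))) =
      ∫ x in Ioi (0 : ℝ), Real.exp (-(1 + a) * x) := by
    refine setIntegral_congr_fun measurableSet_Ioi fun x hx => ?_
    rw [Real.coe_toNNReal _ (le_of_lt hx), one_mul, ← Real.exp_add]
    congr 1
    ring
  rw [h1, integral_exp_mul_Ioi (by linarith), mul_zero, Real.exp_zero, neg_div_neg_eq]

theorem lintegral_toNNReal_expMeasure :
    ∫⁻ x, (x.toNNReal : ℝ≥0∞) ∂(expMeasure 1) = 1 := by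
  have := isProbabilityMeasure_expMeasure one_pos
  have h1 := lintegral_eq_lintegral_meas_lt (expMeasure 1) (f := fun x : ℝ => (x.toNNReal : ℝ))
    (.of_forall fun x => NNReal.coe_nonneg _) (by fun_prop)
  simp only [ENNReal.ofReal_coe_nnreal] at h1
  rw [h1]
  have h2 : ∫⁻ t in Ioi (0 : ℝ), expMeasure 1 {a | t < (a.toNNReal : ℝ)} =
      ∫⁻ t in Ioi (0 : ℝ), ENNReal.ofReal (Real.exp (-t)) := by
    refine setLIntegral_congr_fun measurableSet_Ioi fun t ht => ?_
    have ht0 : (0 : ℝ) < t := ht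
    have : {a : ℝ | t < (a.toNNReal : ℝ)} = Ioi t := by
      ext a
      simp [Real.coe_toNNReal', ht0.not_gt]
    rw [this, ← ofReal_measureReal, expMeasure_real_Ioi ht0.le]
  rw [h2, ← ofReal_integral_eq_lintegral_ofReal, integral_exp_neg_Ioi_zero, ENNReal.ofReal_one]
  · exact integrableOn_exp_neg_Ioi 0
  · exact .of_forall fun t => Real.exp_nonneg _

/-- Fubini on the product law. The inner integral reuses `P` with a second sample point, so that one
variable can be averaged with the other frozen. -/
theorem ProbabilityTheory.IndepFun.integral_eq_integral_integral {Ω β γ : Type*}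
    [MeasurableSpace Ω] [MeasurableSpace β] [MeasurableSpace γ] {P : Measure Ω}
    [IsProbabilityMeasure P] {U : Ω → β} {V : Ω → γ} (h : IndepFun U V P) (hU : Measurable U)
    (hV : Measurable V) {g : β × γ → ℝ} (hg : Measurable g) {B : ℝ} (hB : ∀ p, ‖g p‖ ≤ B) :
    ∫ ω, g (U ω, V ω) ∂P = ∫ ω, ∫ ω', g (U ω, V ω') ∂P ∂P := by
  have : IsProbabilityMeasure (P.map U) := Measure.isProbabilityMeasure_map hU.aemeasurable
  have : IsProbabilityMeasure (P.map V) := Measure.isProbabilityMeasure_map hV.aemeasurable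
  have hmap := (indepFun_iff_map_prod_eq_prod_map_map hU.aemeasurable hV.aemeasurable).1 h
  have hint : Integrable g ((P.map U).prod (P.map V)) :=
    (integrable_const B).mono' hg.aestronglyMeasurable (.of_forall hB)
  rw [← integral_map (f := g) (hU.prodMk hV).aemeasurable hg.aestronglyMeasurable, hmap,
    integral_prod g hint, integral_map hU.aemeasurable
      hg.stronglyMeasurable.integral_prod_right'.aestronglyMeasurable]
  refine integral_congr_ae (.of_forall fun ω => ?_)
  exact integral_map hV.aemeasurable (hg.comp measurable_prodMk_left).aestronglyMeasurable

/-! ### Fading marks and the normalised noise -/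

/-- The marks `W j` carried by the interferers `X j`: non-negative, independent of the locations,
with the joint Laplace transform of i.i.d. variables that are exponential with probability `q` and
zero otherwise; the serving fade `H₀` is exponential and independent of everything else. -/
structure IsFadingMarks {Ω : Type*} [MeasurableSpace Ω] (P : Measure Ω) (X : ℕ → Ω → Plane)
    (H₀ : Ω → ℝ) (W : ℕ → Ω → ℝ≥0) (q : ℝ) : Prop where
  q_pos : 0 < q
  q_le_one : q ≤ 1
  measurable_serving : Measurable H₀
  measurable : ∀ j, Measurable (W j)
  law_serving : P.map H₀ = expMeasure 1
  lintegral_le : ∀ j, ∫⁻ ω, (W j ω : ℝ≥0∞) ∂P ≤ 1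
  laplace : ∀ (n : ℕ) (a : ℕ → ℝ), (∀ j, 0 ≤ a j) →
    ∫ ω, ∏ j ∈ Finset.range n, Real.exp (-(a j * W j ω)) ∂P =
      ∏ j ∈ Finset.range n, (1 - q * (a j / (1 + a j)))
  indep_locations : IndepFun (fun ω j => X j ω) (fun ω j => W j ω) P
  indep_serving : IndepFun H₀ (fun ω => ((fun j => X j ω : ℕ → Plane), (fun j => W j ω : ℕ → ℝ≥0))) P

/-- The path gain from `X j` relative to the serving path gain, and `0` for the serving point. -/
noncomputable def relGain {Ω : Type*} (α : ℝ) (X : ℕ → Ω → Plane) (j : ℕ) (ω : Ω) : ℝ :=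
  if servingDist X ω < ‖X j ω‖ then servingDist X ω ^ α * ‖X j ω‖ ^ (-α) else 0

/-- Noise plus interference, relative to the mean received signal. -/
noncomputable def relNoise {Ω : Type*} (α lam s : ℝ) (X : ℕ → Ω → Plane) (W : ℕ → Ω → ℝ≥0)
    (ω : Ω) : ℝ :=
  s * (lam * servingDist X ω ^ 2) ^ (α / 2) + ∑' j, relGain α X j ω * W j ω

section RelGain

variable {Ω : Type*} {α : ℝ} {X : ℕ → Ω → Plane}

theorem relGain_nonneg (j : ℕ) (ω : Ω) : 0 ≤ relGain α X j ω := by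
  unfold relGain
  have := servingDist_nonneg (X := X) ω
  split_ifs <;> positivity

theorem measurable_relGain [MeasurableSpace Ω] (hX : ∀ j, Measurable (X j)) (j : ℕ) :
    Measurable (relGain α X j) :=
  Measurable.ite (measurableSet_lt (measurable_servingDist hX) (hX j).norm)
    (((measurable_servingDist hX).pow_const _).mul ((hX j).norm.pow_const _)) measurable_const

variable {lam s : ℝ} {W : ℕ → Ω → ℝ≥0}

theorem relNoise_nonneg (hlam : 0 ≤ lam) (hs : 0 ≤ s) (ω : Ω) :
    0 ≤ relNoise α lam s X W ω := by
  refine add_nonneg (by positivity) (tsum_nonneg fun j => ?_)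
  exact mul_nonneg (relGain_nonneg j ω) (NNReal.coe_nonneg _)

theorem measurable_relNoise [MeasurableSpace Ω] (hX : ∀ j, Measurable (X j))
    (hW : ∀ j, Measurable (W j)) : Measurable (relNoise α lam s X W) := by
  refine Measurable.add ?_ (measurable_real_tsum (fun j =>
    (measurable_relGain hX j).mul (hW j).coe_nnreal_real) fun j ω =>
      mul_nonneg (relGain_nonneg j ω) (NNReal.coe_nonneg _))
  exact ((((measurable_servingDist hX).pow_const 2).const_mul _).pow_const _).const_mul _

end RelGain

/-! ### The logarithmic Laplace transform of a mark -/

/-- `-log E[exp (-a W)]` for `W` exponential with probability `q` and zero otherwise. -/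
noncomputable def logLaplace (q a : ℝ) : ℝ := -Real.log (1 - q * (a / (1 + a)))

section LogLaplace

variable {q a : ℝ}

/-- The left side is the case `q = 1`. The bound keeps the argument of the logarithm positive and
gives `logLaplace q a ≤ log (1 + a) ≤ a`. -/
theorem inv_le_one_sub (hq1 : q ≤ 1) (ha : 0 ≤ a) :
    1 / (1 + a) ≤ 1 - q * (a / (1 + a)) := by
  have h1 : a / (1 + a) = 1 - 1 / (1 + a) := by field_simp; ring
  have h2 : 0 ≤ a / (1 + a) := by positivity
  nlinarith

theorem exp_neg_logLaplace (hq1 : q ≤ 1) (ha : 0 ≤ a) :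
    Real.exp (-logLaplace q a) = 1 - q * (a / (1 + a)) := by
  rw [logLaplace, neg_neg, Real.exp_log]
  exact lt_of_lt_of_le (by positivity) (inv_le_one_sub hq1 ha)

theorem logLaplace_nonneg (hq : 0 ≤ q) (hq1 : q ≤ 1) (ha : 0 ≤ a) : 0 ≤ logLaplace q a := by
  have h1 := exp_neg_logLaplace hq1 ha
  have h2 : Real.exp (-logLaplace q a) ≤ 1 := by
    rw [h1]
    have : 0 ≤ q * (a / (1 + a)) := by positivity
    linarith
  simpa using h2

theorem logLaplace_le (hq1 : q ≤ 1) (ha : 0 ≤ a) : logLaplace q a ≤ a := by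
  have h1 : Real.exp (-a) ≤ Real.exp (-logLaplace q a) := by
    rw [exp_neg_logLaplace hq1 ha, Real.exp_neg, ← one_div]
    refine le_trans ?_ (inv_le_one_sub hq1 ha)
    gcongr
    linarith [Real.add_one_le_exp a]
  have := Real.exp_le_exp.1 h1
  linarith

theorem measurable_logLaplace : Measurable (logLaplace q) := by
  unfold logLaplace; fun_prop

theorem continuousOn_logLaplace (hq1 : q ≤ 1) : ContinuousOn (logLaplace q) (Ici 0) := by
  unfold logLaplace
  refine ContinuousOn.neg (ContinuousOn.log ?_ fun a ha => ?_)
  · refine continuousOn_const.sub (continuousOn_const.mul (continuousOn_id.div (by fun_prop) ?_))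
    intro a ha
    have : (0 : ℝ) ≤ a := ha
    positivity
  · have ha' : (0 : ℝ) ≤ a := ha
    exact (lt_of_lt_of_le (by positivity) (inv_le_one_sub hq1 ha')).ne'

end LogLaplace

/-! ### Convergence of the interference, and averaging over finitely many marks -/

section Core

variable {Ω : Type*} [MeasurableSpace Ω] {P : Measure Ω} [IsProbabilityMeasure P]
  {X : ℕ → Ω → Plane} {H₀ : Ω → ℝ} {W : ℕ → Ω → ℝ≥0} {lam α q : ℝ}

namespace IsFadingMarks

/-- Outside a fixed ball the expected sum is at most that without marks, which Campbell's formula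
bounds. The random radius `R > 0` exceeds some `1 / (n + 1)`. -/
theorem ae_summable_mul (hW : IsFadingMarks P X H₀ W q) (hX : IsPoissonProcess P X lam)
    (hlam : 0 < lam) (hα : 2 < α) :
    ∀ᵐ ω ∂P, Summable fun j =>
      (if servingDist X ω < ‖X j ω‖ then ‖X j ω‖ ^ (-α) else 0) * (W j ω : ℝ) := by
  have h1 : ∀ n : ℕ, ∀ᵐ ω ∂P, Summable fun j =>
      (if 1 / ((n : ℝ) + 1) ≤ ‖X j ω‖ then ‖X j ω‖ ^ (-α) else 0) * (W j ω : ℝ) := by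
    intro n
    set b : Plane → ℝ := fun x => if 1 / ((n : ℝ) + 1) ≤ ‖x‖ then ‖x‖ ^ (-α) else 0 with hb
    have hb0 : ∀ x, 0 ≤ b x := fun x => by simp only [hb]; split_ifs <;> positivity
    have hbm : Measurable b := Measurable.ite (measurableSet_le measurable_const measurable_norm)
      (measurable_norm.pow_const _) measurable_const
    have hbi : Integrable b := integrable_rpow_outside hα (by positivity)
    have hm : ∀ j, Measurable fun ω => ENNReal.ofReal (b (X j ω)) * (W j ω : ℝ≥0∞) := fun j =>
      (hbm.comp (hX.measurable j)).ennreal_ofReal.mul (hW.measurable j).coe_nnreal_ennreal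
    have hfin : ∫⁻ ω, ∑' j, ENNReal.ofReal (b (X j ω)) * (W j ω : ℝ≥0∞) ∂P ≠ ∞ := by
      rw [lintegral_tsum fun j => (hm j).aemeasurable]
      have hle : ∀ j, ∫⁻ ω, ENNReal.ofReal (b (X j ω)) * (W j ω : ℝ≥0∞) ∂P ≤
          ∫⁻ ω, ENNReal.ofReal (b (X j ω)) ∂P := by
        intro j
        have hind : IndepFun (fun ω => ENNReal.ofReal (b (X j ω)))
            (fun ω => (W j ω : ℝ≥0∞)) P :=
          hW.indep_locations.comp
            (show Measurable fun x : ℕ → Plane => ENNReal.ofReal (b (x j)) from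
              (hbm.comp (measurable_pi_apply j)).ennreal_ofReal)
            (show Measurable fun w : ℕ → ℝ≥0 => (w j : ℝ≥0∞) from
              (measurable_pi_apply j).coe_nnreal_ennreal)
        have := lintegral_mul_eq_lintegral_mul_lintegral_of_indepFun''
          (hbm.comp (hX.measurable j)).ennreal_ofReal.aemeasurable
          (hW.measurable j).coe_nnreal_ennreal.aemeasurable hind
        refine this.trans_le ?_
        exact mul_le_of_le_one_right' (hW.lintegral_le j)
      refine ((ENNReal.tsum_le_tsum hle).trans_lt ?_).ne
      rw [← lintegral_tsum (f := fun j ω => ENNReal.ofReal (b (X j ω)))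
        fun j => (hbm.comp (hX.measurable j)).ennreal_ofReal.aemeasurable,
        hX.lintegral_tsum hlam.le hbm.ennreal_ofReal]
      exact ENNReal.mul_lt_top ENNReal.ofReal_lt_top hbi.lintegral_lt_top
    filter_upwards [ae_lt_top (Measurable.tsum hm) hfin] with ω hω
    have := ENNReal.summable_toReal hω.ne
    simpa only [ENNReal.toReal_mul, ENNReal.toReal_ofReal (hb0 _), ENNReal.coe_toReal] using this
  filter_upwards [ae_all_iff.2 h1, hX.ae_servingDist_pos hlam] with ω hω hR
  obtain ⟨n, hn⟩ := exists_nat_one_div_lt hR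
  refine (hω n).of_nonneg_of_le (fun j => ?_) fun j => ?_
  · exact mul_nonneg (by split_ifs <;> positivity) (NNReal.coe_nonneg _)
  · refine mul_le_mul_of_nonneg_right ?_ (NNReal.coe_nonneg _)
    split_ifs with h2 h3
    · exact le_rfl
    · exact absurd (hn.le.trans h2.le) h3
    · positivity
    · exact le_rfl

theorem ae_summable_relGain_mul (hW : IsFadingMarks P X H₀ W q) (hX : IsPoissonProcess P X lam)
    (hlam : 0 < lam) (hα : 2 < α) :
    ∀ᵐ ω ∂P, Summable fun j => relGain α X j ω * (W j ω : ℝ) := by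
  filter_upwards [hW.ae_summable_mul hX hlam hα] with ω hω
  refine (hω.mul_left (servingDist X ω ^ α)).congr fun j => ?_
  rw [relGain]
  split_ifs <;> ring

/-- Averaging over the marks of finitely many points. -/
theorem integral_exp_neg_sum_range (hW : IsFadingMarks P X H₀ W q) (hX : ∀ j, Measurable (X j))
    {w : ℝ → ℝ} (hw : Measurable w) {B : ℝ} (hwB : ∀ r, ‖w r‖ ≤ B) {T : ℝ} (hT : 0 ≤ T) (n : ℕ) :
    ∫ ω, w (servingDist X ω) *
        Real.exp (-(T * ∑ j ∈ Finset.range n, relGain α X j ω * W j ω)) ∂P =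
      ∫ ω, w (servingDist X ω) *
        Real.exp (-∑ j ∈ Finset.range n, logLaplace q (T * relGain α X j ω)) ∂P := by
  -- The serving distance and the gains depend on `ω` only through the sequence of points. Reading
  -- them on the sequence space makes them functions of the independent pair (locations, marks).
  let X' : ℕ → (ℕ → Plane) → Plane := fun j x => x j
  have hX' : ∀ j, Measurable (X' j) := fun j => measurable_pi_apply j
  have hsum0 : ∀ (x : ℕ → Plane) (v : ℕ → ℝ≥0),
      0 ≤ ∑ j ∈ Finset.range n, relGain α X' j x * (v j : ℝ) := fun x v =>
    Finset.sum_nonneg fun j _ => mul_nonneg (relGain_nonneg j x) (NNReal.coe_nonneg _)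
  have hB0 : ∀ r u : ℝ, 0 ≤ u → ‖w r * Real.exp (-u)‖ ≤ B := by
    intro r u hu
    rw [norm_mul, Real.norm_of_nonneg (Real.exp_nonneg _)]
    exact (mul_le_of_le_one_right (norm_nonneg _)
      (Real.exp_le_one_iff.2 (neg_nonpos.2 hu))).trans (hwB _)
  have hF := hW.indep_locations.integral_eq_integral_integral
    (measurable_pi_lambda _ hX) (measurable_pi_lambda _ hW.measurable)
    (g := fun p : (ℕ → Plane) × (ℕ → ℝ≥0) => w (servingDist X' p.1) *
      Real.exp (-(T * ∑ j ∈ Finset.range n, relGain α X' j p.1 * (p.2 j : ℝ))))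
    (by
      refine (hw.comp ((measurable_servingDist hX').comp measurable_fst)).mul
        (((Finset.measurable_sum _ fun j _ => ?_).const_mul _).neg.exp)
      exact ((measurable_relGain hX' j).comp measurable_fst).mul
        ((measurable_pi_apply j).comp measurable_snd).coe_nnreal_real)
    (B := B) fun p => hB0 _ _ (mul_nonneg hT (hsum0 _ _))
  refine hF.trans (integral_congr_ae (.of_forall fun ω => ?_))
  have h2 : ∀ ω', Real.exp (-(T * ∑ j ∈ Finset.range n, relGain α X j ω * (W j ω' : ℝ))) =
      ∏ j ∈ Finset.range n, Real.exp (-((T * relGain α X j ω) * W j ω')) := by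
    intro ω'
    rw [← Real.exp_sum, Finset.sum_neg_distrib, Finset.mul_sum]
    simp_rw [mul_assoc]
  have h3 : ∀ j, 0 ≤ T * relGain α X j ω := fun j => mul_nonneg hT (relGain_nonneg j ω)
  change ∫ ω', w (servingDist X ω) *
    Real.exp (-(T * ∑ j ∈ Finset.range n, relGain α X j ω * (W j ω' : ℝ))) ∂P = _
  rw [integral_const_mul]
  simp_rw [h2]
  rw [hW.laplace n _ h3, ← Finset.sum_neg_distrib, Real.exp_sum]
  simp_rw [exp_neg_logLaplace hW.q_le_one (h3 _)]

end IsFadingMarks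

end Core

/-! ### The coverage integral -/

/-- The coverage probability at threshold `T`, with relative noise `s` and active fraction `q`. -/
noncomputable def coverage (α s q T : ℝ) : ℝ :=
  Real.pi * ∫ x in Ioi (0 : ℝ),
    Real.exp (-(s * T * x ^ (α / 2)) - Real.pi * x * (q * rho T α + 1))

section Coverage

variable {α s q T : ℝ}

theorem coverage_nonneg : 0 ≤ coverage α s q T :=
  mul_nonneg Real.pi_pos.le (integral_nonneg fun _ => Real.exp_nonneg _)

theorem exp_coverage_le (hs : 0 ≤ s) (hT : 0 ≤ T) {x : ℝ} (hx : 0 < x) :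
    Real.exp (-(s * T * x ^ (α / 2)) - Real.pi * x * (q * rho T α + 1)) ≤
      Real.exp (-(Real.pi * (q * rho T α + 1)) * x) := by
  refine Real.exp_le_exp.2 ?_
  have : 0 ≤ s * T * x ^ (α / 2) := by positivity
  linarith

theorem integrableOn_exp_coverage (hα : 2 < α) (hs : 0 ≤ s) (hq : 0 ≤ q) (hT : 0 ≤ T) :
    IntegrableOn (fun x => Real.exp (-(s * T * x ^ (α / 2)) -
      Real.pi * x * (q * rho T α + 1))) (Ioi 0) := by
  have hρ := rho_nonneg hα hT
  have h1 : IntegrableOn (fun x => Real.exp (-(Real.pi * (q * rho T α + 1)) * x)) (Ioi 0) :=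
    exp_neg_integrableOn_Ioi 0 (by have := Real.pi_pos; positivity)
  refine h1.mono' (show Measurable _ by fun_prop).aestronglyMeasurable ?_
  filter_upwards [ae_restrict_mem measurableSet_Ioi] with x hx
  rw [Real.norm_of_nonneg (Real.exp_nonneg _)]
  exact exp_coverage_le hs hT hx

/-- Dropping the noise leaves an exponential integral. -/
theorem coverage_le (hα : 2 < α) (hs : 0 ≤ s) (hq : 0 ≤ q) (hT : 0 ≤ T) :
    coverage α s q T ≤ 1 / (q * rho T α + 1) := by
  have hρ := rho_nonneg hα hT
  have hpos : 0 < Real.pi * (q * rho T α + 1) := by have := Real.pi_pos; positivity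
  have h1 : ∫ x in Ioi (0 : ℝ), Real.exp (-(s * T * x ^ (α / 2)) -
      Real.pi * x * (q * rho T α + 1)) ≤
      ∫ x in Ioi (0 : ℝ), Real.exp (-(Real.pi * (q * rho T α + 1)) * x) :=
    setIntegral_mono_on (integrableOn_exp_coverage hα hs hq hT) (exp_neg_integrableOn_Ioi 0 hpos)
      measurableSet_Ioi fun x hx => exp_coverage_le hs hT hx
  rw [integral_exp_mul_Ioi (by linarith), mul_zero, Real.exp_zero, neg_div_neg_eq] at h1
  refine (mul_le_mul_of_nonneg_left h1 Real.pi_pos.le).trans_eq ?_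
  have := Real.pi_pos
  field_simp

/-- The exponential decay in `t` behind the integrability of the rate and of the double integral. -/
theorem coverage_two_rpow_le (hα : 2 < α) (hs : 0 ≤ s) (hq : 0 < q) (hq1 : q ≤ 1) {t : ℝ}
    (ht : 0 ≤ t) : coverage α s q (2 ^ t - 1) ≤
      2 / q * Real.exp (-(Real.log 2 * (2 / α)) * t) := by
  have hT : (0 : ℝ) ≤ 2 ^ t - 1 := sub_nonneg.2 (Real.one_le_rpow one_le_two ht)
  refine (coverage_le hα hs hq.le hT).trans ?_
  have h1 := le_mul_rho_add_one hα hq hq1 ht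
  have h2 : (0 : ℝ) < 2 ^ (2 / α * t) := by positivity
  calc 1 / (q * rho (2 ^ t - 1) α + 1) ≤ 1 / (q / 2 * 2 ^ (2 / α * t)) :=
        one_div_le_one_div_of_le (by positivity) h1
    _ = 2 / q * (2 ^ (2 / α * t))⁻¹ := by field_simp
    _ = _ := by
        rw [Real.rpow_def_of_pos two_pos, ← Real.exp_neg]
        congr 2
        ring

/-- Continuity of `rho` gives measurability; Tonelli reduces the rest to the exponential bound on
the coverage. -/
theorem integrableOn_exp_coverage_prod (hα : 2 < α) (hs : 0 ≤ s) (hq : 0 < q) (hq1 : q ≤ 1) :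
    IntegrableOn (fun p : ℝ × ℝ => Real.exp (-(s * (2 ^ p.1 - 1) * p.2 ^ (α / 2)) -
      Real.pi * p.2 * (q * rho (2 ^ p.1 - 1) α + 1))) (Ioi 0 ×ˢ Ioi 0) := by
  have hα0 : 0 < α := by linarith
  have hT : ∀ t : ℝ, 0 < t → (0 : ℝ) ≤ 2 ^ t - 1 := fun t ht =>
    sub_nonneg.2 (Real.one_le_rpow one_le_two ht.le)
  have hpow : Continuous fun p : ℝ × ℝ => (2 : ℝ) ^ p.1 - 1 :=
    ((Real.continuous_const_rpow two_ne_zero).comp continuous_fst).sub continuous_const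
  have hρ : ContinuousOn (fun p : ℝ × ℝ => rho (2 ^ p.1 - 1) α) (Ioi 0 ×ˢ Ioi 0) :=
    (continuousOn_rho hα).comp hpow.continuousOn fun p hp => hT _ hp.1
  have hx : Continuous fun p : ℝ × ℝ => p.2 ^ (α / 2) :=
    (Real.continuous_rpow_const (by positivity)).comp continuous_snd
  have hcont : ContinuousOn (fun p : ℝ × ℝ => Real.exp (-(s * (2 ^ p.1 - 1) * p.2 ^ (α / 2)) -
      Real.pi * p.2 * (q * rho (2 ^ p.1 - 1) α + 1))) (Ioi 0 ×ˢ Ioi 0) := by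
    refine ContinuousOn.rexp (ContinuousOn.sub ?_ ?_)
    · exact (((continuous_const.mul hpow).mul hx).neg).continuousOn
    · exact (continuous_const.mul continuous_snd).continuousOn.mul
        ((continuousOn_const.mul hρ).add continuousOn_const)
  have hmeas := hcont.aestronglyMeasurable (μ := volume)
    (measurableSet_Ioi.prod (measurableSet_Ioi (a := (0 : ℝ))))
  rw [Measure.volume_eq_prod, ← Measure.prod_restrict] at hmeas
  rw [IntegrableOn, Measure.volume_eq_prod, ← Measure.prod_restrict, integrable_prod_iff hmeas]
  constructor
  · filter_upwards [ae_restrict_mem measurableSet_Ioi] with t ht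
    exact integrableOn_exp_coverage hα hs hq.le (hT t ht)
  · have hb : IntegrableOn (fun t : ℝ => Real.pi⁻¹ *
        (2 / q * Real.exp (-(Real.log 2 * (2 / α)) * t))) (Ioi 0) := by
      refine Integrable.const_mul (Integrable.const_mul (exp_neg_integrableOn_Ioi 0 ?_) _) _
      have := Real.log_pos one_lt_two
      positivity
    refine hb.mono' hmeas.norm.integral_prod_right' ?_
    filter_upwards [ae_restrict_mem measurableSet_Ioi] with t ht
    have h1 := coverage_two_rpow_le hα hs hq hq1 (le_of_lt ht)
    rw [coverage, ← le_inv_mul_iff₀ Real.pi_pos] at h1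
    simp only [Real.norm_eq_abs, Real.abs_exp]
    rwa [abs_of_nonneg (integral_nonneg fun _ => Real.exp_nonneg _)]

end Coverage

/-! ### From the Laplace transform of the noise to the mean rate -/

section Core

variable {Ω : Type*} [MeasurableSpace Ω] {P : Measure Ω} [IsProbabilityMeasure P]
  {X : ℕ → Ω → Plane} {H₀ : Ω → ℝ} {W : ℕ → Ω → ℝ≥0} {lam α q s T : ℝ}

namespace IsFadingMarks

/-- Averaging over all the marks. -/
theorem integral_exp_neg_tsum (hW : IsFadingMarks P X H₀ W q) (hX : IsPoissonProcess P X lam)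
    (hlam : 0 < lam) (hα : 2 < α) {w : ℝ → ℝ} (hw : Measurable w) {B : ℝ}
    (hwB : ∀ r, ‖w r‖ ≤ B) (hT : 0 ≤ T) :
    ∫ ω, w (servingDist X ω) * Real.exp (-(T * ∑' j, relGain α X j ω * W j ω)) ∂P =
      ∫ ω, w (servingDist X ω) * Real.exp (-∑' j, logLaplace q (T * relGain α X j ω)) ∂P := by
  have hwm : Measurable fun ω => w (servingDist X ω) :=
    hw.comp (measurable_servingDist hX.measurable)
  have hbd : ∀ r u : ℝ, 0 ≤ u → ‖w r * Real.exp (-u)‖ ≤ B := by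
    intro r u hu
    rw [norm_mul, Real.norm_of_nonneg (Real.exp_nonneg _)]
    exact (mul_le_of_le_one_right (norm_nonneg _)
      (Real.exp_le_one_iff.2 (neg_nonpos.2 hu))).trans (hwB _)
  have hg0 : ∀ j ω, 0 ≤ T * relGain α X j ω := fun j ω => mul_nonneg hT (relGain_nonneg j ω)
  have hgm := measurable_relGain (α := α) hX.measurable
  -- Both sides are limits along the partial sums, for which `integral_exp_neg_sum_range` gives
  -- equality.
  have hL : Tendsto (fun n => ∫ ω, w (servingDist X ω) *
      Real.exp (-(T * ∑ j ∈ Finset.range n, relGain α X j ω * W j ω)) ∂P) atTop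
      (𝓝 (∫ ω, w (servingDist X ω) *
        Real.exp (-(T * ∑' j, relGain α X j ω * W j ω)) ∂P)) := by
    refine tendsto_integral_of_dominated_convergence (fun _ => B) (fun n => ?_)
      (integrable_const _) (fun n => .of_forall fun ω => ?_) ?_
    · exact (hwm.mul ((Finset.measurable_sum _ fun j _ => (hgm j).mul
        (hW.measurable j).coe_nnreal_real).const_mul _).neg.exp).aestronglyMeasurable
    · exact hbd _ _ (mul_nonneg hT (Finset.sum_nonneg fun j _ =>
        mul_nonneg (relGain_nonneg j ω) (NNReal.coe_nonneg _)))
    · filter_upwards [hW.ae_summable_relGain_mul hX hlam hα] with ω hω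
      exact ((Real.continuous_exp.tendsto _).comp
        (hω.hasSum.tendsto_sum_nat.const_mul T).neg).const_mul _
  have hR : Tendsto (fun n => ∫ ω, w (servingDist X ω) *
      Real.exp (-∑ j ∈ Finset.range n, logLaplace q (T * relGain α X j ω)) ∂P) atTop
      (𝓝 (∫ ω, w (servingDist X ω) *
        Real.exp (-∑' j, logLaplace q (T * relGain α X j ω)) ∂P)) := by
    have hl0 : ∀ j ω, 0 ≤ logLaplace q (T * relGain α X j ω) := fun j ω =>
      logLaplace_nonneg hW.q_pos.le hW.q_le_one (hg0 j ω)
    refine tendsto_integral_of_dominated_convergence (fun _ => B) (fun n => ?_)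
      (integrable_const _) (fun n => .of_forall fun ω => ?_) ?_
    · exact (hwm.mul (Finset.measurable_sum _ fun j _ =>
        measurable_logLaplace.comp ((hgm j).const_mul T)).neg.exp).aestronglyMeasurable
    · exact hbd _ _ (Finset.sum_nonneg fun j _ => hl0 j ω)
    · filter_upwards [hX.summable_outside hlam.le hα, hX.ae_servingDist_pos hlam] with ω hsum hRω
      have h1 : Summable fun j => T * relGain α X j ω := by
        refine (((hsum _ hRω).mul_left (servingDist X ω ^ α)).mul_left T).of_nonneg_of_le
          (hg0 · ω) fun j => ?_
        unfold relGain
        refine mul_le_mul_of_nonneg_left ?_ hT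
        split_ifs with h2 h3
        · exact le_rfl
        · exact absurd h2.le h3
        · positivity
        · simp
      have h2 : Summable fun j => logLaplace q (T * relGain α X j ω) :=
        h1.of_nonneg_of_le (hl0 · ω) fun j => logLaplace_le hW.q_le_one (hg0 j ω)
      exact ((Real.continuous_exp.tendsto _).comp h2.hasSum.tendsto_sum_nat.neg).const_mul _
  refine tendsto_nhds_unique hL (hR.congr fun n => ?_)
  exact (hW.integral_exp_neg_sum_range hX.measurable hw hwB hT n).symm

/-- The heart of the computation: average over the marks, then over the points beyond `R`, then over
`lam * R ^ 2`, which is exponential with rate `π`. -/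
theorem integral_exp_neg_relNoise (hW : IsFadingMarks P X H₀ W q) (hX : IsPoissonProcess P X lam)
    (hlam : 0 < lam) (hα : 2 < α) (hs : 0 ≤ s) (hT : 0 ≤ T) :
    ∫ ω, Real.exp (-(T * relNoise α lam s X W ω)) ∂P = coverage α s q T := by
  have hα0 : 0 < α := by linarith
  -- The noise depends on `R` alone, so it passes through the conditioning as a bounded continuous
  -- weight.
  set w : ℝ → ℝ := fun r => Real.exp (-(T * (s * (lam * r ^ 2) ^ (α / 2)))) with hw
  have hwc : Continuous w := by
    refine Real.continuous_exp.comp (Continuous.neg (continuous_const.mul (continuous_const.mul ?_)))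
    exact (Real.continuous_rpow_const (by positivity)).comp (by fun_prop)
  have hwB : ∀ r, ‖w r‖ ≤ 1 := fun r => by
    rw [Real.norm_of_nonneg (Real.exp_nonneg _), Real.exp_le_one_iff, neg_nonpos]
    positivity
  set h : ℝ → ℝ := fun v => logLaplace q (T * v ^ (-α)) with hh
  have ha0 : ∀ v, 1 ≤ v → 0 ≤ T * v ^ (-α) := fun v hv => by
    have : 0 < v := by linarith
    positivity
  have hhm : Measurable h := measurable_logLaplace.comp (by fun_prop)
  have hcont : ContinuousOn h (Ici 1) := by
    refine (continuousOn_logLaplace hW.q_le_one).comp (continuousOn_const.mul ?_) fun v hv => ha0 v hv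
    exact continuousOn_id.rpow_const fun v hv => Or.inl (zero_lt_one.trans_le (mem_Ici.1 hv)).ne'
  have hint : ∫ v in Ioi (1 : ℝ), v * (1 - Real.exp (-h v)) =
      q * ∫ v in Ioi (1 : ℝ), v * (T * v ^ (-α) / (1 + T * v ^ (-α))) := by
    rw [← integral_const_mul]
    refine setIntegral_congr_fun measurableSet_Ioi fun v hv => ?_
    simp only [hh]
    rw [exp_neg_logLaplace hW.q_le_one (ha0 v (le_of_lt hv))]
    ring
  have hκ : 2 * ∫ v in Ioi (1 : ℝ), v * (1 - Real.exp (-h v)) = q * rho T α := by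
    rw [hint, rho_eq_integral hα hT]
    ring
  have hm : Measurable fun ω => lam * servingDist X ω ^ 2 :=
    ((measurable_servingDist hX.measurable).pow_const 2).const_mul lam
  calc ∫ ω, Real.exp (-(T * relNoise α lam s X W ω)) ∂P
      = ∫ ω, w (servingDist X ω) *
          Real.exp (-(T * ∑' j, relGain α X j ω * W j ω)) ∂P := by
        refine integral_congr_ae (.of_forall fun ω => ?_)
        simp only [hw, relNoise]
        rw [← Real.exp_add]
        congr 1
        ring
    _ = ∫ ω, w (servingDist X ω) *
          Real.exp (-∑' j, logLaplace q (T * relGain α X j ω)) ∂P :=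
        hW.integral_exp_neg_tsum hX hlam hα hwc.measurable hwB hT
    _ = ∫ ω, w (servingDist X ω) * Real.exp (-∑' j, if servingDist X ω < ‖X j ω‖ then
          h (‖X j ω‖ / servingDist X ω) else 0) ∂P := by
        refine integral_congr_ae ?_
        filter_upwards [hX.ae_servingDist_pos hlam] with ω hR
        congr 3
        refine tsum_congr fun j => ?_
        unfold relGain
        split_ifs with hj
        · simp only [hh]
          rw [Real.div_rpow (norm_nonneg _) hR.le, Real.rpow_neg hR.le, div_inv_eq_mul,
            mul_comm (servingDist X ω ^ α)]
        · simp [logLaplace]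
    _ = ∫ ω, w (servingDist X ω) * Real.exp (-(lam * (Real.pi * servingDist X ω ^ 2 *
          (q * rho T α)))) ∂P := by
        rw [hX.integral_servingDist_exp hlam hα hT hhm hcont
          (fun v hv => logLaplace_nonneg hW.q_pos.le hW.q_le_one (ha0 v hv))
          (fun v hv => logLaplace_le hW.q_le_one (ha0 v hv)) hwc hwB, hκ]
    _ = ∫ ω, (fun z => Real.exp (-(T * (s * z ^ (α / 2))) - Real.pi * z * (q * rho T α)))
          (lam * servingDist X ω ^ 2) ∂P := by
        refine integral_congr_ae (.of_forall fun ω => ?_)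
        simp only [hw]
        rw [← Real.exp_add]
        congr 1
        ring
    _ = coverage α s q T := by
        rw [← integral_map (f := fun z : ℝ => Real.exp (-(T * (s * z ^ (α / 2))) -
            Real.pi * z * (q * rho T α))) hm.aemeasurable
            (show Measurable _ by fun_prop).aestronglyMeasurable,
          hX.map_servingDist_sq hlam, integral_expMeasure Real.pi_pos, coverage,
          ← integral_const_mul]
        refine integral_congr_ae (.of_forall fun x => ?_)
        simp only
        rw [mul_assoc, ← Real.exp_add]
        congr 2
        ring

/-- Freeze points and marks and integrate out the serving fade, whose tail at `y ≥ 0` is `exp (-y)`.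
-/
theorem measureReal_mul_relNoise_lt (hW : IsFadingMarks P X H₀ W q)
    (hX : IsPoissonProcess P X lam) (hlam : 0 < lam) (hα : 2 < α) (hs : 0 ≤ s) (hT : 0 ≤ T) :
    P.real {ω | T * relNoise α lam s X W ω < H₀ ω} = coverage α s q T := by
  let X' : ℕ → (ℕ → Plane) × (ℕ → ℝ≥0) → Plane := fun j p => p.1 j
  let W' : ℕ → (ℕ → Plane) × (ℕ → ℝ≥0) → ℝ≥0 := fun j p => p.2 j
  have hX' : ∀ j, Measurable (X' j) := fun j => (measurable_pi_apply j).comp measurable_fst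
  have hW' : ∀ j, Measurable (W' j) := fun j => (measurable_pi_apply j).comp measurable_snd
  have hY' : Measurable (relNoise α lam s X' W') := measurable_relNoise hX' hW'
  have hY : Measurable (relNoise α lam s X W) := measurable_relNoise hX.measurable hW.measurable
  have hS : MeasurableSet {p : ((ℕ → Plane) × (ℕ → ℝ≥0)) × ℝ |
      T * relNoise α lam s X' W' p.1 < p.2} :=
    measurableSet_lt ((hY'.comp measurable_fst).const_mul T) measurable_snd
  have h := hW.indep_serving.symm.integral_eq_integral_integral
    ((measurable_pi_lambda _ hX.measurable).prodMk (measurable_pi_lambda _ hW.measurable))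
    hW.measurable_serving
    (g := {p : ((ℕ → Plane) × (ℕ → ℝ≥0)) × ℝ |
      T * relNoise α lam s X' W' p.1 < p.2}.indicator 1) (measurable_const.indicator hS) (B := 1)
    fun p => by
      by_cases hp : p ∈ {p : ((ℕ → Plane) × (ℕ → ℝ≥0)) × ℝ | T * relNoise α lam s X' W' p.1 < p.2}
      · simp [indicator_of_mem hp]
      · simp [indicator_of_notMem hp]
  rw [← hW.integral_exp_neg_relNoise hX hlam hα hs hT]
  have hSω : MeasurableSet {ω | T * relNoise α lam s X W ω < H₀ ω} :=
    measurableSet_lt (hY.const_mul T) hW.measurable_serving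
  rw [← integral_indicator_one hSω]
  refine Eq.trans h (integral_congr_ae (.of_forall fun ω => ?_))
  have hy : 0 ≤ T * relNoise α lam s X W ω := mul_nonneg hT (relNoise_nonneg hlam.le hs ω)
  change ∫ ω', (H₀ ⁻¹' Ioi (T * relNoise α lam s X W ω)).indicator 1 ω' ∂P = _
  rw [integral_indicator_one (hW.measurable_serving measurableSet_Ioi),
    ← map_measureReal_apply hW.measurable_serving measurableSet_Ioi, hW.law_serving,
    expMeasure_real_Ioi hy]

/-- Without thermal noise positivity is not evident, and division by zero would give SINR zero. On
the null set of the noise `exp (-T Y) = 1` for every `T`, so its probability is at most the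
coverage, which tends to zero. -/
theorem ae_relNoise_pos (hW : IsFadingMarks P X H₀ W q)
    (hX : IsPoissonProcess P X lam) (hlam : 0 < lam) (hα : 2 < α) (hs : 0 ≤ s) :
    ∀ᵐ ω ∂P, 0 < relNoise α lam s X W ω := by
  have hY : Measurable (relNoise α lam s X W) := measurable_relNoise hX.measurable hW.measurable
  have h0 : MeasurableSet {ω | relNoise α lam s X W ω = 0} := hY (measurableSet_singleton 0)
  have hle : ∀ t : ℝ, 0 ≤ t → P.real {ω | relNoise α lam s X W ω = 0} ≤
      2 / q * Real.exp (-(Real.log 2 * (2 / α)) * t) := by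
    intro t ht
    have hT : (0 : ℝ) ≤ 2 ^ t - 1 := sub_nonneg.2 (Real.one_le_rpow one_le_two ht)
    refine le_trans ?_ (coverage_two_rpow_le hα hs hW.q_pos hW.q_le_one ht)
    rw [← hW.integral_exp_neg_relNoise hX hlam hα hs hT, ← integral_indicator_one h0]
    refine integral_mono ((integrable_const (1 : ℝ)).indicator h0) ?_ fun ω => ?_
    · refine (integrable_const (1 : ℝ)).mono' (hY.const_mul _).neg.exp.aestronglyMeasurable
        (.of_forall fun ω => ?_)
      rw [Real.norm_of_nonneg (Real.exp_nonneg _), Real.exp_le_one_iff, neg_nonpos]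
      exact mul_nonneg hT (relNoise_nonneg hlam.le hs ω)
    · by_cases hω : relNoise α lam s X W ω = 0
      · rw [indicator_of_mem (by exact hω), hω]
        simp
      · rw [indicator_of_notMem (by exact hω)]
        exact Real.exp_nonneg _
  have hlim : Tendsto (fun t : ℝ => 2 / q * Real.exp (-(Real.log 2 * (2 / α)) * t)) atTop
      (𝓝 (2 / q * 0)) := by
    refine Tendsto.const_mul _ (Real.tendsto_exp_atBot.comp ?_)
    refine tendsto_id.const_mul_atTop_of_neg ?_
    have := Real.log_pos one_lt_two
    have : 0 < Real.log 2 * (2 / α) := by positivity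
    linarith
  have hzero : P.real {ω | relNoise α lam s X W ω = 0} = 0 := by
    refine le_antisymm ?_ measureReal_nonneg
    have := ge_of_tendsto hlim ((eventually_ge_atTop 0).mono hle)
    simpa using this
  have hae : ∀ᵐ ω ∂P, ¬ relNoise α lam s X W ω = 0 :=
    measure_eq_zero_iff_ae_notMem.1 ((measureReal_eq_zero_iff).1 hzero)
  filter_upwards [hae] with ω hω
  exact (relNoise_nonneg hlam.le hs ω).lt_of_ne (Ne.symm hω)

omit [IsProbabilityMeasure P] in
theorem ae_serving_nonneg (hW : IsFadingMarks P X H₀ W q) : ∀ᵐ ω ∂P, 0 ≤ H₀ ω := by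
  have h : ∀ᵐ x ∂(P.map H₀), 0 ≤ x := by
    rw [hW.law_serving]
    exact ae_nonneg_expMeasure
  exact ae_of_ae_map hW.measurable_serving.aemeasurable h

/-- The layer-cake formula: `t < logb 2 (1 + H₀ / Y)` means `(2 ^ t - 1) * Y < H₀`, an event whose
probability is the coverage. -/
theorem integrable_logb_and_integral_eq (hW : IsFadingMarks P X H₀ W q)
    (hX : IsPoissonProcess P X lam) (hlam : 0 < lam) (hα : 2 < α) (hs : 0 ≤ s) :
    Integrable (fun ω => Real.logb 2 (1 + H₀ ω / relNoise α lam s X W ω)) P ∧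
      ∫ ω, Real.logb 2 (1 + H₀ ω / relNoise α lam s X W ω) ∂P =
        ∫ t in Ioi (0 : ℝ), coverage α s q (2 ^ t - 1) := by
  set u : Ω → ℝ := fun ω => Real.logb 2 (1 + H₀ ω / relNoise α lam s X W ω) with hu
  have hY : Measurable (relNoise α lam s X W) := measurable_relNoise hX.measurable hW.measurable
  have hum : Measurable u :=
    (Real.measurable_log.comp ((hW.measurable_serving.div hY).const_add 1)).div_const _
  have hu0 : ∀ᵐ ω ∂P, 0 ≤ u ω := by
    filter_upwards [hW.ae_serving_nonneg] with ω hω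
    refine Real.logb_nonneg one_lt_two ?_
    have := div_nonneg hω (relNoise_nonneg (α := α) (X := X) (W := W) hlam.le hs ω)
    linarith
  have hlt : ∀ t : ℝ, 0 < t → P {ω | t < u ω} = ENNReal.ofReal (coverage α s q (2 ^ t - 1)) := by
    intro t ht
    have hT : (0 : ℝ) ≤ 2 ^ t - 1 := sub_nonneg.2 (Real.one_le_rpow one_le_two ht.le)
    rw [← hW.measureReal_mul_relNoise_lt hX hlam hα hs hT, ofReal_measureReal]
    refine measure_congr ?_
    filter_upwards [hW.ae_serving_nonneg, hW.ae_relNoise_pos hX hlam hα hs] with ω h1 h2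
    refine propext ?_
    change t < u ω ↔ _ < _
    have h3 := div_nonneg h1 h2.le
    rw [hu, Real.lt_logb_iff_rpow_lt one_lt_two (by linarith), ← sub_lt_iff_lt_add',
      lt_div_iff₀ h2]
  -- Being a tail probability, the coverage is monotone in `t`, hence measurable.
  have hmono : AntitoneOn (fun t : ℝ => coverage α s q (2 ^ t - 1)) (Ioi 0) := by
    intro t ht t' ht' htt
    have h1 : P {ω | t' < u ω} ≤ P {ω | t < u ω} := measure_mono fun ω hω => htt.trans_lt hω
    rw [hlt t ht, hlt t' ht'] at h1
    exact (ENNReal.ofReal_le_ofReal_iff coverage_nonneg).1 h1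
  have hcov : IntegrableOn (fun t : ℝ => coverage α s q (2 ^ t - 1)) (Ioi 0) := by
    have hb : IntegrableOn (fun t : ℝ => 2 / q * Real.exp (-(Real.log 2 * (2 / α)) * t))
        (Ioi 0) := by
      refine Integrable.const_mul (exp_neg_integrableOn_Ioi 0 ?_) _
      have := Real.log_pos one_lt_two
      positivity
    refine hb.mono' (aemeasurable_restrict_of_antitoneOn measurableSet_Ioi
      hmono).aestronglyMeasurable ?_
    filter_upwards [ae_restrict_mem measurableSet_Ioi] with t ht
    rw [Real.norm_of_nonneg coverage_nonneg]
    exact coverage_two_rpow_le hα hs hW.q_pos hW.q_le_one (le_of_lt ht)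
  have hlint : ∫⁻ ω, ENNReal.ofReal (u ω) ∂P =
      ENNReal.ofReal (∫ t in Ioi (0 : ℝ), coverage α s q (2 ^ t - 1)) := by
    rw [lintegral_eq_lintegral_meas_lt P hu0 hum.aemeasurable,
      ofReal_integral_eq_lintegral_ofReal hcov (.of_forall fun _ => coverage_nonneg)]
    exact setLIntegral_congr_fun measurableSet_Ioi fun t ht => hlt t ht
  have hui : Integrable u P :=
    (lintegral_ofReal_ne_top_iff_integrable hum.aestronglyMeasurable hu0).1
      (hlint ▸ ENNReal.ofReal_ne_top)
  refine ⟨hui, ?_⟩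
  rw [integral_eq_lintegral_of_nonneg_ae hu0 hum.aestronglyMeasurable, hlint,
    ENNReal.toReal_ofReal (integral_nonneg fun _ => coverage_nonneg)]

end IsFadingMarks

end Core

/-! ### Regrouping independent variables -/

namespace ProbabilityTheory

variable {Ω : Type*} [MeasurableSpace Ω] {P : Measure Ω} [IsProbabilityMeasure P]

/-- On boxes the joint law is `P(U) P(A, B) = P(U) P(A) P(B) = P(A) P(U, B)`. This moves a variable
across an independent pair. -/
theorem IndepFun.prodMk_of_indepFun {β γ δ : Type*}
    [MeasurableSpace β] [MeasurableSpace γ] [MeasurableSpace δ] {U : Ω → β} {A : Ω → γ} {B : Ω → δ}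
    (h : IndepFun U (fun ω => (A ω, B ω)) P) (hAB : IndepFun A B P) (hU : Measurable U)
    (hA : Measurable A) (hB : Measurable B) : IndepFun A (fun ω => (U ω, B ω)) P := by
  have hUB : IndepFun U B P := h.comp measurable_id measurable_snd
  have h1 : IsProbabilityMeasure (P.map fun ω => (A ω, U ω, B ω)) :=
    Measure.isProbabilityMeasure_map (hA.prodMk (hU.prodMk hB)).aemeasurable
  rw [indepFun_iff_map_prod_eq_prod_map_map hA.aemeasurable (hU.prodMk hB).aemeasurable]
  refine Measure.ext_prod₃ fun {s t u} hs ht hu => ?_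
  rw [Measure.map_apply (hA.prodMk (hU.prodMk hB)) (hs.prod (ht.prod hu)), Measure.prod_prod,
    Measure.map_apply hA hs, Measure.map_apply (hU.prodMk hB) (ht.prod hu)]
  have e1 : (fun ω => (A ω, U ω, B ω)) ⁻¹' s ×ˢ t ×ˢ u =
      U ⁻¹' t ∩ (fun ω => (A ω, B ω)) ⁻¹' s ×ˢ u := by
    ext ω; simp; tauto
  have e2 : (fun ω => (A ω, B ω)) ⁻¹' s ×ˢ u = A ⁻¹' s ∩ B ⁻¹' u := by
    ext ω; simp
  have e3 : (fun ω => (U ω, B ω)) ⁻¹' t ×ˢ u = U ⁻¹' t ∩ B ⁻¹' u := by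
    ext ω; simp
  rw [e1, h.measure_inter_preimage_eq_mul _ _ ht (hs.prod hu), e2, e3,
    hAB.measure_inter_preimage_eq_mul _ _ hs hu, hUB.measure_inter_preimage_eq_mul _ _ ht hu]
  ring

omit [IsProbabilityMeasure P] in
theorem iIndepFun.indepFun_none_some {H₀ : Ω → ℝ} {H : ℕ → Ω → ℝ} (hH₀ : Measurable H₀)
    (hH : ∀ j, Measurable (H j)) (h : iIndepFun (fun o : Option ℕ => o.elim H₀ H) P) :
    IndepFun H₀ (fun ω j => H j ω) P := by
  have hle : ∀ o : Option ℕ, MeasurableSpace.comap (o.elim H₀ H) inferInstance ≤ ‹_› := by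
    rintro (_ | j)
    · exact hH₀.comap_le
    · exact (hH j).comap_le
  have hd : Disjoint ({none} : Set (Option ℕ)) (range some) := by simp
  have h1 := indep_iSup_of_disjoint hle h hd
  refine indep_of_indep_of_le_left (indep_of_indep_of_le_right h1 ?_) ?_
  · rw [iSup_range, MeasurableSpace.pi, MeasurableSpace.comap_iSup]
    refine iSup_mono fun j => ?_
    rw [MeasurableSpace.comap_comp]
    exact le_rfl
  · rw [iSup_singleton]
    exact le_rfl

omit [IsProbabilityMeasure P] in
theorem iIndepFun.integral_prod_range {β : Type*} [MeasurableSpace β] {V : ℕ → Ω → β}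
    (h : iIndepFun V P) (hV : ∀ j, Measurable (V j)) {g : ℕ → β → ℝ} (hg : ∀ j, Measurable (g j))
    (n : ℕ) :
    ∫ ω, ∏ j ∈ Finset.range n, g j (V j ω) ∂P = ∏ j ∈ Finset.range n, ∫ ω, g j (V j ω) ∂P := by
  have h1 := ((h.comp g hg).precomp (g := fun i : Fin n => (i : ℕ))
    Fin.val_injective).integral_fun_prod_eq_prod_integral fun i =>
      ((hg _).comp (hV _)).aestronglyMeasurable
  simp only [Finset.prod_range]
  exact h1

end ProbabilityTheory

/-! ### The two schemes as marked processes, and the rate -/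

section Rate

variable {Ω : Type*} [MeasurableSpace Ω] {P : Measure Ω} [IsProbabilityMeasure P]
  {X : ℕ → Ω → Plane} {H₀ : Ω → ℝ} {H : ℕ → Ω → ℝ} {W : ℕ → Ω → ℝ≥0} {lam α q : ℝ}

omit [IsProbabilityMeasure P] in
theorem IsRayleighFading.ae_nonneg (hH : IsRayleighFading P X H₀ H) : ∀ᵐ ω ∂P, ∀ j, 0 ≤ H j ω := by
  refine ae_all_iff.2 fun j => ?_
  have h : ∀ᵐ x ∂(P.map (H j)), 0 ≤ x := by
    rw [hH.law_interf j]
    exact ae_nonneg_expMeasure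
  exact ae_of_ae_map (hH.measurable_interf j).aemeasurable h

omit [IsProbabilityMeasure P] in
theorem IsRayleighFading.lintegral_toNNReal (hH : IsRayleighFading P X H₀ H) (j : ℕ) :
    ∫⁻ ω, ((H j ω).toNNReal : ℝ≥0∞) ∂P = 1 := by
  rw [← lintegral_toNNReal_expMeasure, ← hH.law_interf j,
    lintegral_map (by fun_prop) (hH.measurable_interf j)]

omit [IsProbabilityMeasure P] in
theorem IsRayleighFading.integral_exp_neg_mul_toNNReal (hH : IsRayleighFading P X H₀ H) (j : ℕ)
    {a : ℝ} (ha : 0 ≤ a) :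
    ∫ ω, Real.exp (-(a * ((H j ω).toNNReal : ℝ))) ∂P = 1 / (1 + a) := by
  rw [← integral_exp_neg_mul_toNNReal_expMeasure ha, ← hH.law_interf j,
    integral_map (hH.measurable_interf j).aemeasurable
      (show Measurable _ by fun_prop).aestronglyMeasurable]

omit [IsProbabilityMeasure P] in
theorem IsRayleighFading.iIndepFun_interf (hH : IsRayleighFading P X H₀ H) : iIndepFun H P :=
  hH.iIndep.precomp (g := some) (Option.some_injective ℕ)

omit [IsProbabilityMeasure P] in
theorem IsRayleighFading.integral_prod_exp (hH : IsRayleighFading P X H₀ H) (n : ℕ) {a : ℕ → ℝ}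
    (ha : ∀ j, 0 ≤ a j) :
    ∫ ω, ∏ j ∈ Finset.range n, Real.exp (-(a j * ((H j ω).toNNReal : ℝ))) ∂P =
      ∏ j ∈ Finset.range n, 1 / (1 + a j) := by
  rw [hH.iIndepFun_interf.integral_prod_range hH.measurable_interf
    (g := fun j x => Real.exp (-(a j * (x.toNNReal : ℝ)))) (fun j => by fun_prop)]
  exact Finset.prod_congr rfl fun j _ => hH.integral_exp_neg_mul_toNNReal j (ha j)

theorem IsRayleighFading.indepFun_serving (hX : ∀ j, Measurable (X j))
    (hH : IsRayleighFading P X H₀ H) :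
    IndepFun H₀ (fun ω => ((fun j => X j ω : ℕ → Plane), (fun j => H j ω : ℕ → ℝ))) P :=
  hH.indep_locations.prodMk_of_indepFun
    (hH.iIndep.indepFun_none_some hH.measurable_serving hH.measurable_interf)
    (measurable_pi_lambda _ hX) hH.measurable_serving (measurable_pi_lambda _ hH.measurable_interf)

/-- The all-on scheme. Truncating the fades at zero changes them only on a null set and makes the
marks `ℝ≥0`-valued. -/
theorem IsRayleighFading.isFadingMarks (hX : ∀ j, Measurable (X j))
    (hH : IsRayleighFading P X H₀ H) :
    IsFadingMarks P X H₀ (fun j ω => (H j ω).toNNReal) 1 where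
  q_pos := one_pos
  q_le_one := le_rfl
  measurable_serving := hH.measurable_serving
  measurable j := (hH.measurable_interf j).real_toNNReal
  law_serving := hH.law_serving
  lintegral_le j := (hH.lintegral_toNNReal j).le
  laplace n a ha := by
    rw [hH.integral_prod_exp n ha]
    refine Finset.prod_congr rfl fun j _ => ?_
    have := ha j
    field_simp
    ring
  indep_locations := by
    have hm : Measurable fun p : ℝ × (ℕ → ℝ) => fun j => (p.2 j).toNNReal := by fun_prop
    exact hH.indep_locations.comp measurable_id hm
  indep_serving := by
    have hm : Measurable fun p : (ℕ → Plane) × (ℕ → ℝ) => (p.1, fun j => (p.2 j).toNNReal) := by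
      fun_prop
    exact (hH.indepFun_serving hX).comp measurable_id hm

/-- The mass at zero is all that is used of the law of the cell counts. -/
theorem cellCountProb_zero {μ : ℝ} (hμ : 0 < μ) : cellCountProb μ 0 = voidProb μ := by
  have hΓ : Real.Gamma 3.5 ≠ 0 := (Real.Gamma_pos_of_pos (by norm_num)).ne'
  have h1 : (1 + μ / 3.5 : ℝ) = (μ + 3.5) / 3.5 := by field_simp; ring
  rw [cellCountProb, voidProb, h1, Real.rpow_neg (by positivity),
    Real.div_rpow (by positivity) (by norm_num)]
  simp only [Nat.cast_zero, zero_add, pow_zero, mul_one, Nat.factorial_zero, Nat.cast_one]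
  have h2 : (0 : ℝ) < (μ + 3.5) ^ (3.5 : ℝ) := by positivity
  field_simp

theorem voidProb_lt_one {μ : ℝ} (hμ : 0 < μ) : voidProb μ < 1 :=
  Real.rpow_lt_one_of_one_lt_of_neg (by have : 0 < μ / 3.5 := by positivity
                                        linarith) (by norm_num)

theorem voidProb_nonneg {μ : ℝ} (hμ : 0 < μ) : 0 ≤ voidProb μ := by
  unfold voidProb; positivity

/-- The on-off scheme. The mark has Laplace transform `p₀ + (1 - p₀) / (1 + a)`, which is `1 - q *
(a / (1 + a))` for `q = 1 - p₀`. -/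
theorem IsCellCounts.isFadingMarks {N : ℕ → Ω → ℕ} {μ : ℝ} (hμ : 0 < μ)
    (hX : ∀ j, Measurable (X j)) (hH : IsRayleighFading P X H₀ H)
    (hN : IsCellCounts P X H₀ H N μ) :
    IsFadingMarks P X H₀ (fun j ω => if N j ω = 0 then 0 else (H j ω).toNNReal)
      (1 - voidProb μ) where
  q_pos := sub_pos.2 (voidProb_lt_one hμ)
  q_le_one := sub_le_self _ (voidProb_nonneg hμ)
  measurable_serving := hH.measurable_serving
  measurable j := Measurable.ite (hN.measurable j (measurableSet_singleton 0)) measurable_const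
    (hH.measurable_interf j).real_toNNReal
  law_serving := hH.law_serving
  lintegral_le j := by
    refine le_trans (lintegral_mono fun ω => ?_) (hH.lintegral_toNNReal j).le
    split_ifs
    · simp
    · exact le_rfl
  laplace n a ha := by
    -- An empty cell is recorded by a zero coefficient instead of a zero fade; with the counts
    -- frozen, the product over fades is then the one already computed.
    let b : ℕ → ℕ → ℝ := fun j k => if k = 0 then 0 else a j
    have hb : ∀ j k, 0 ≤ b j k := fun j k => by
      simp only [b]; split_ifs
      · exact le_rfl
      · exact ha j
    have hNH : IndepFun (fun ω j => N j ω) (fun ω j => H j ω) P :=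
      hN.indep_rest.comp measurable_id (measurable_snd.comp measurable_snd)
    have hbm : ∀ j, Measurable (b j) := fun j => .of_discrete
    have hF := hNH.integral_eq_integral_integral (measurable_pi_lambda _ hN.measurable)
      (measurable_pi_lambda _ hH.measurable_interf)
      (g := fun p : (ℕ → ℕ) × (ℕ → ℝ) => ∏ j ∈ Finset.range n,
        Real.exp (-(b j (p.1 j) * ((p.2 j).toNNReal : ℝ))))
      (Finset.measurable_prod _ fun j _ => by
        have hm : Measurable fun p : (ℕ → ℕ) × (ℕ → ℝ) => b j (p.1 j) :=
          (hbm j).comp ((measurable_pi_apply j).comp measurable_fst)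
        exact (hm.mul (by fun_prop)).neg.exp) (B := 1) fun p => by
        rw [norm_prod]
        refine Finset.prod_le_one (fun _ _ => norm_nonneg _) fun j _ => ?_
        rw [Real.norm_of_nonneg (Real.exp_nonneg _), Real.exp_le_one_iff, neg_nonpos]
        exact mul_nonneg (hb _ _) (NNReal.coe_nonneg _)
    have hsingle : ∀ j, ∫ ω, 1 / (1 + b j (N j ω)) ∂P =
        1 - (1 - voidProb μ) * (a j / (1 + a j)) := by
      intro j
      have hS : MeasurableSet {ω | N j ω = 0} := hN.measurable j (measurableSet_singleton 0)
      have h1 : ∀ ω, 1 / (1 + b j (N j ω)) =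
          1 / (1 + a j) + {ω | N j ω = 0}.indicator (fun _ => a j / (1 + a j)) ω := by
        intro ω
        have := ha j
        by_cases h : N j ω = 0
        · rw [indicator_of_mem (by exact h)]
          simp only [b, h, if_true]
          field_simp
          ring
        · rw [indicator_of_notMem (by exact h)]
          simp [b, h]
      simp_rw [h1]
      rw [integral_add (integrable_const _) ((integrable_const _).indicator hS), integral_const,
        integral_indicator_const _ hS, measureReal_def, measureReal_def, hN.law j 0,
        cellCountProb_zero hμ, ENNReal.toReal_ofReal (voidProb_nonneg hμ)]
      have := ha j
      simp
      field_simp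
      ring
    calc ∫ ω, ∏ j ∈ Finset.range n,
          Real.exp (-(a j * ((if N j ω = 0 then 0 else (H j ω).toNNReal : ℝ≥0) : ℝ))) ∂P
        = ∫ ω, ∏ j ∈ Finset.range n, Real.exp (-(b j (N j ω) * ((H j ω).toNNReal : ℝ))) ∂P := by
          refine integral_congr_ae (.of_forall fun ω => Finset.prod_congr rfl fun j _ => ?_)
          by_cases h : N j ω = 0 <;> simp [b, h]
      _ = ∫ ω, ∫ ω', ∏ j ∈ Finset.range n,
            Real.exp (-(b j (N j ω) * ((H j ω').toNNReal : ℝ))) ∂P ∂P := hF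
      _ = ∫ ω, ∏ j ∈ Finset.range n, 1 / (1 + b j (N j ω)) ∂P :=
          integral_congr_ae (.of_forall fun ω => hH.integral_prod_exp n fun j => hb j _)
      _ = ∏ j ∈ Finset.range n, ∫ ω, 1 / (1 + b j (N j ω)) ∂P :=
          hN.iIndep.integral_prod_range hN.measurable (g := fun j k => 1 / (1 + b j k))
            (fun j => .of_discrete) n
      _ = _ := Finset.prod_congr rfl fun j _ => hsingle j
  indep_locations := by
    have h1 : IndepFun (fun ω j => N j ω)
        (fun ω => ((fun j => X j ω : ℕ → Plane), (fun j => H j ω : ℕ → ℝ))) P := by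
      have hm : Measurable fun p : (ℕ → Plane) × ℝ × (ℕ → ℝ) => (p.1, p.2.2) := by fun_prop
      exact hN.indep_rest.comp measurable_id hm
    -- Counts are independent of (locations, fades), and these of each other; hence locations are
    -- independent of (counts, fades), of which the marks are functions.
    have h2 := h1.prodMk_of_indepFun (hH.indep_locations.comp measurable_id measurable_snd)
      (measurable_pi_lambda _ hN.measurable) (measurable_pi_lambda _ hX)
      (measurable_pi_lambda _ hH.measurable_interf)
    have hm : Measurable fun p : (ℕ → ℕ) × (ℕ → ℝ) => fun j =>
        if p.1 j = 0 then (0 : ℝ≥0) else (p.2 j).toNNReal :=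
      measurable_pi_lambda _ fun j => Measurable.ite
        (measurableSet_eq_fun (by fun_prop) measurable_const) measurable_const (by fun_prop)
    exact h2.comp measurable_id hm
  indep_serving := by
    have h1 : IndepFun (fun ω j => N j ω)
        (fun ω => (H₀ ω, (fun j => X j ω : ℕ → Plane), (fun j => H j ω : ℕ → ℝ))) P := by
      have hm : Measurable fun p : (ℕ → Plane) × ℝ × (ℕ → ℝ) => (p.2.1, p.1, p.2.2) := by fun_prop
      exact hN.indep_rest.comp measurable_id hm
    have h2 := h1.prodMk_of_indepFun (hH.indepFun_serving hX)
      (measurable_pi_lambda _ hN.measurable) hH.measurable_serving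
      ((measurable_pi_lambda _ hX).prodMk (measurable_pi_lambda _ hH.measurable_interf))
    have hm : Measurable fun p : (ℕ → ℕ) × (ℕ → Plane) × (ℕ → ℝ) => (p.2.1, fun j =>
        if p.1 j = 0 then (0 : ℝ≥0) else (p.2.2 j).toNNReal) :=
      Measurable.prodMk (by fun_prop) (measurable_pi_lambda _ fun j => Measurable.ite
        (measurableSet_eq_fun (by fun_prop) measurable_const) measurable_const (by fun_prop))
    exact h2.comp measurable_id hm

/-- The mean rate when the transmitting interferers have fading marks `W`. -/
theorem IsFadingMarks.rate_integral (hW : IsFadingMarks P X H₀ W q)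
    (hX : IsPoissonProcess P X lam) {C σ Pr0 : ℝ} (hC : 0 < C) (hlam : 0 < lam) (hα : 2 < α)
    (hPr0 : 0 < Pr0) {active : Ω → Set ℕ}
    (hact : ∀ᵐ ω ∂P, ∀ j, (active ω).indicator (fun j => H j ω) j = W j ω) :
    (∀ᵐ ω ∂P, Summable (interferenceTerm C (transmitPower C Pr0 lam α) α X H active ω)) ∧
      Integrable (rate C (transmitPower C Pr0 lam α) α σ X H₀ H active) P ∧
      IntegrableOn (fun p : ℝ × ℝ =>
          Real.exp (-(σ ^ 2 * (2 ^ p.1 - 1) / Pr0 * p.2 ^ (α / 2)) -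
            Real.pi * p.2 * (q * rho (2 ^ p.1 - 1) α + 1))) (Ioi 0 ×ˢ Ioi 0) ∧
      ∫ ω, rate C (transmitPower C Pr0 lam α) α σ X H₀ H active ω ∂P =
        Real.pi * ∫ t in Ioi (0 : ℝ), ∫ x in Ioi (0 : ℝ),
          Real.exp (-(σ ^ 2 * (2 ^ t - 1) / Pr0 * x ^ (α / 2)) -
            Real.pi * x * (q * rho (2 ^ t - 1) α + 1)) := by
  set Pt := transmitPower C Pr0 lam α with hPt
  have hs : 0 ≤ σ ^ 2 / Pr0 := by positivity
  -- The transmit power is chosen so that `C` cancels and the density enters the noise only through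
  -- `lam * R ^ 2`.
  have hCP : C * Pt = Pr0 / lam ^ (α / 2) := by
    rw [hPt, transmitPower]
    field_simp
  have hCP0 : 0 < C * Pt := by rw [hCP]; positivity
  have hterm : ∀ᵐ ω ∂P, ∀ j, interferenceTerm C Pt α X H active ω j =
      C * Pt * ((if servingDist X ω < ‖X j ω‖ then ‖X j ω‖ ^ (-α) else 0) * W j ω) := by
    filter_upwards [hact] with ω hω j
    rw [← hω j, interferenceTerm]
    by_cases h1 : j ∈ active ω <;> by_cases h2 : servingDist X ω < ‖X j ω‖
    · rw [indicator_of_mem (by exact ⟨h1, h2⟩), indicator_of_mem h1, if_pos h2]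
      ring
    · rw [indicator_of_notMem (fun h => h2 h.2), if_neg h2]
      ring
    · rw [indicator_of_notMem (fun h => h1 h.1), indicator_of_notMem h1]
      ring
    · rw [indicator_of_notMem (fun h => h1 h.1), indicator_of_notMem h1]
      ring
  have hsum : ∀ᵐ ω ∂P, Summable (interferenceTerm C Pt α X H active ω) := by
    filter_upwards [hterm, hW.ae_summable_mul hX hlam hα] with ω h1 h2
    exact (h2.mul_left (C * Pt)).congr fun j => (h1 j).symm
  have hrate : rate C Pt α σ X H₀ H active =ᵐ[P]
      fun ω => Real.logb 2 (1 + H₀ ω / relNoise α lam (σ ^ 2 / Pr0) X W ω) := by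
    filter_upwards [hterm, hX.ae_servingDist_pos hlam] with ω h1 hR
    rw [rate, sinr]
    congr 2
    set R := servingDist X ω with hRdef
    have hk : 0 < C * Pt * R ^ (-α) := by positivity
    -- Pulling the mean received signal out of the denominator leaves `relNoise`.
    have hden : σ ^ 2 + ∑' j, interferenceTerm C Pt α X H active ω j =
        relNoise α lam (σ ^ 2 / Pr0) X W ω * (C * Pt * R ^ (-α)) := by
      have hRR : R ^ α * R ^ (-α) = 1 := by
        rw [← Real.rpow_add hR, add_neg_cancel, Real.rpow_zero]
      simp_rw [h1]
      rw [relNoise, add_mul, tsum_mul_left, ← tsum_mul_right, ← tsum_mul_left]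
      congr 1
      · have h2 : (R ^ 2) ^ (α / 2) = R ^ α := by
          rw [← Real.rpow_natCast, ← Real.rpow_mul hR.le]
          congr 1
          push_cast
          ring
        rw [← hRdef, Real.mul_rpow hlam.le (by positivity), h2, hCP]
        have : lam ^ (α / 2) ≠ 0 := (Real.rpow_pos_of_pos hlam _).ne'
        have h3 : σ ^ 2 / Pr0 * (lam ^ (α / 2) * R ^ α) * (Pr0 / lam ^ (α / 2) * R ^ (-α)) =
            σ ^ 2 * (R ^ α * R ^ (-α)) := by
          field_simp
        rw [h3, hRR, mul_one]
      · refine tsum_congr fun j => ?_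
        rw [relGain, ← hRdef]
        split_ifs
        · rw [show R ^ α * ‖X j ω‖ ^ (-α) * W j ω * (C * Pt * R ^ (-α)) =
            C * Pt * (‖X j ω‖ ^ (-α) * W j ω) * (R ^ α * R ^ (-α)) by ring, hRR, mul_one]
        · ring
    rw [hden, show H₀ ω * C * Pt * R ^ (-α) = H₀ ω * (C * Pt * R ^ (-α)) by ring,
      mul_div_mul_right _ _ hk.ne']
  obtain ⟨hint, hval⟩ := hW.integrable_logb_and_integral_eq hX hlam hα hs
  have hexp : ∀ t x : ℝ, σ ^ 2 * (2 ^ t - 1) / Pr0 * x ^ (α / 2) =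
      σ ^ 2 / Pr0 * (2 ^ t - 1) * x ^ (α / 2) := fun t x => by ring
  refine ⟨hsum, hint.congr hrate.symm, ?_, ?_⟩
  · simp_rw [hexp]
    exact integrableOn_exp_coverage_prod hα hs hW.q_pos hW.q_le_one
  · rw [integral_congr_ae hrate, hval]
    simp_rw [hexp]
    rw [← integral_const_mul]
    rfl

end Rate

theorem lemma2 {Ω : Type*} [MeasurableSpace Ω] (P : Measure Ω) [IsProbabilityMeasure P]
    (C α σ Pr0 lamb lamu : ℝ) (hC : 0 < C) (hα : 2 < α) (hPr0 : 0 < Pr0)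
    (hlamb : 0 < lamb) (hlamu : 0 < lamu)
    (X : ℕ → Ω → Plane) (H₀ : Ω → ℝ) (H : ℕ → Ω → ℝ)
    (hX : IsPoissonProcess P X lamb) (hH : IsRayleighFading P X H₀ H) :
    -- all-on power control
    ((∀ᵐ ω ∂P, Summable
        (interferenceTerm C (transmitPower C Pr0 lamb α) α X H allOn ω)) ∧
      Integrable (rate C (transmitPower C Pr0 lamb α) α σ X H₀ H allOn) P ∧
      IntegrableOn (fun p : ℝ × ℝ =>
          Real.exp (-(σ ^ 2 * (2 ^ p.1 - 1) / Pr0 * p.2 ^ (α / 2)) -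
            Real.pi * p.2 * (rho (2 ^ p.1 - 1) α + 1))) (Ioi 0 ×ˢ Ioi 0) ∧
      ∫ ω, rate C (transmitPower C Pr0 lamb α) α σ X H₀ H allOn ω ∂P =
        Real.pi * ∫ t in Ioi (0 : ℝ), ∫ x in Ioi (0 : ℝ),
          Real.exp (-(σ ^ 2 * (2 ^ t - 1) / Pr0 * x ^ (α / 2)) -
            Real.pi * x * (rho (2 ^ t - 1) α + 1))) ∧
    -- on-off power control, with cell load `lamu / lamb`
    (∀ N : ℕ → Ω → ℕ, IsCellCounts P X H₀ H N (lamu / lamb) →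
      (∀ᵐ ω ∂P, Summable
        (interferenceTerm C (transmitPower C Pr0 lamb α) α X H (onOff N) ω)) ∧
      Integrable (rate C (transmitPower C Pr0 lamb α) α σ X H₀ H (onOff N)) P ∧
      IntegrableOn (fun p : ℝ × ℝ =>
          Real.exp (-(σ ^ 2 * (2 ^ p.1 - 1) / Pr0 * p.2 ^ (α / 2)) -
            Real.pi * p.2 * ((1 - voidProb (lamu / lamb)) * rho (2 ^ p.1 - 1) α + 1)))
        (Ioi 0 ×ˢ Ioi 0) ∧
      ∫ ω, rate C (transmitPower C Pr0 lamb α) α σ X H₀ H (onOff N) ω ∂P =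
        Real.pi * ∫ t in Ioi (0 : ℝ), ∫ x in Ioi (0 : ℝ),
          Real.exp (-(σ ^ 2 * (2 ^ t - 1) / Pr0 * x ^ (α / 2)) -
            Real.pi * x * ((1 - voidProb (lamu / lamb)) * rho (2 ^ t - 1) α + 1))) := by
  have hmarks := hH.isFadingMarks hX.measurable
  refine ⟨?_, fun N hN => ?_⟩
  · have hact : ∀ᵐ ω ∂P, ∀ j, (allOn ω).indicator (fun j => H j ω) j =
        ((H j ω).toNNReal : ℝ) := by
      filter_upwards [hH.ae_nonneg] with ω hω j
      rw [Real.coe_toNNReal _ (hω j), allOn, indicator_univ]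
    simpa only [one_mul] using hmarks.rate_integral hX (σ := σ) hC hlamb hα hPr0 hact
  · have hact : ∀ᵐ ω ∂P, ∀ j, (onOff N ω).indicator (fun j => H j ω) j =
        ((if N j ω = 0 then 0 else (H j ω).toNNReal : ℝ≥0) : ℝ) := by
      filter_upwards [hH.ae_nonneg] with ω hω j
      by_cases h : N j ω = 0
      · rw [indicator_of_notMem (fun hj : N j ω ≠ 0 => hj h), if_pos h, NNReal.coe_zero]
      · rw [indicator_of_mem (by exact h), if_neg h, Real.coe_toNNReal _ (hω j)]
    exact (hN.isFadingMarks (div_pos hlamu hlamb) hX.measurable hH).rate_integral hX hC hlamb hα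
      hPr0 hact
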